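/- Consider a slotted network with mobile stations $1,\dots,N$ and a base station $0$, a finite set $\mathcal S$ of topologies and finitely many power vectors $\ell_1,\dots,\ell_M$, where $\ell_{ijk}\ge 0$ is the power spent on link $(i,j)$, $i\in\{1,\dots,N\}$, $j\in\{0,\dots,N\}$, under $\ell_k$. Each station transmits to at most one receiver (other than itself) in a slot. Link $(i,j)$ can carry $\mu_{ij}(s,\ell_k)\in\{0,1,2,\dots\}$ packets per slot in topology $s$, and none if $\ell_{ijk}=0$. The average power of station $i$ is limited by $\overline P_i$. All $\ell_{ijk}$ and $\overline P_i$ are non-negative integer multiples of some unit $u>0$. Station $i$ has an own queue $X_i$, a relay queue $Y_i$ and a virtual power queue $U_i$. In slot $n$, with topology $s(n)$, power vector $\ell(n)$, exogenous arrivals $A_i(n)$ and indicators $I_i(n)\in\{0,1\}$ telling whether station $i$ serves its own queue ($I_i=1$) or its relay queue ($I_i=0$) on link $(i,0)$, put $\mu_{ij}=\mu_{ij}(s(n),\ell(n))$, $D_{ij}=\min(X_i(n),\mu_{ij})$ for $j\ne 0$, $D_{i0}=I_i(n)\min(X_i(n),\mu_{i0})$ and $D_{iR}=(1-I_i(n))\min(Y_i(n),\mu_{i0})$.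 Then $$X_i(n+1)=X_i(n)-\sum_{j\ne i}D_{ij}-D_{i0}+A_i(n),\quad Y_i(n+1)=Y_i(n)-D_{iR}+\sum_{j\neq i}D_{ji},\quad U_i(n+1)=\max(U_i(n)-\overline P_i,0)+\sum_{j=0,\,j\ne i}^N\ell_{ij}(n),$$ where the first two sums are over stations $j\in\{1,\dots,N\}$. The topologies $s(n)$ are i.i.d. with law $\pi$, the bounded integer arrival vectors $A(n)$ are i.i.d. with mean vector $\lambda$, and the two sequences are independent of each other. The vector $\lambda$ is called stabilizable if there is a (possibly randomized and history-dependent, non-anticipating) policy for choosing $\ell(n)$ and $I(n)$ under which the long-run averages $\overline\mu_{ij}$ of $\mu_{ij}$, $\overline\mu_{i0}$ of $\mu_{i0}I_i$, $\overline\mu_{iR}$ of $\mu_{i0}(1-I_i)$ and $\overline P^{\Delta}_i$ of $\sum_{j=0,\,j\ne i}^N\ell_{ij}$ exist almost surely as constants and satisfy, for all $i$, $$\lambda_i<\overline\mu_{i0}+\sum_{j\ne i}\overline\mu_{ij},\qquad \sum_{j\ne i}\overline\mu_{ji}<\overline\mu_{iR},\qquad \overline P_i^{\Delta}<\overline P_i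 .$$ The policy $\Delta^o_{IID}$ chooses in each slot a power vector $\ell_k$ that maximizes $$\sum_{i=1}^N\Big[\sum_{j=1,\,j\ne i}^N (X_i(n)-Y_j(n))\,\mu_{ij}(s(n),\ell_k)+\max\{X_i(n),Y_i(n)\}\,\mu_{i0}(s(n),\ell_k)-U_i(n)\sum_{j=0,\,j\neq i}^N\ell_{ijk}\Big],$$ and on each link $(i,0)$ serves the longer of the queues $X_i(n),Y_i(n)$; ties are broken in an arbitrary fixed way depending on the queues and the topology. Let $\lambda$ be stabilizable. Then $\Delta^o_{IID}$ stabilizes the system: from each initial state (with each $U_i(0)$ a non-negative integer multiple of $u$) the process $(X(n),Y(n),U(n))_{n\ge 0}$ is a homogeneous countable Markov chain, it is positive recurrent, and all expected queue lengths are finite under its stationary distribution. Irreducibility is not assumed, and this means: every state of a closed communicating class has finite expected return time, and from each initial state the expected time until a closed communicating class is entered is finite (so if the chain is irreducible, every state is positive recurrent); each closed communicating class carries exactly one stationary distribution; and $X_i$, $Y_i$, $U_i$ have finite expectation, for all $i$, under every stationary distribution. -/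

import Mathlib

open MeasureTheory ProbabilityTheory Filter Topology
open scoped ENNReal

/-! ### Countable Markov chains

A transition law is a map `P : E → PMF E`; `P x y` is the probability to go from `x` to `y` in one
step. Processes are given as families `Z x n ω`, the
position after `n` steps, on the sample point `ω`, of the process started in `x`. -/

namespace Chain

/-- `Z` is a Markov chain with transition law `P`: the probability of each finite path is
multiplied by `P (z n) (z (n + 1))` when the path is prolonged by one step. -/
def IsMarkov {Ω E : Type*} [MeasurableSpace Ω] (m : Measure Ω) (P : E → PMF E)
    (Z : ℕ → Ω → E) : Prop :=
  ∀ (n : ℕ) (z : ℕ → E),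
    m {ω | ∀ k ≤ n + 1, Z k ω = z k} = m {ω | ∀ k ≤ n, Z k ω = z k} * P (z n) (z (n + 1))

/-- `y` can be reached from `x` (in zero or more steps of positive probability). -/
def Reach {E : Type*} (P : E → PMF E) : E → E → Prop :=
  Relation.ReflTransGen (fun x y => P x y ≠ 0)

/-- `x` is essential: the states reachable from `x` form a closed communicating class.
The chain is irreducible exactly when all states communicate, and then all are essential. -/
def Essential {E : Type*} (P : E → PMF E) (x : E) : Prop :=
  ∀ y, Reach P x y → Reach P y x

/-- The first time `n ≥ a` at which the path is in `B` (`⊤` if there is none). -/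
noncomputable def firstTime {Ω E : Type*} (a : ℕ) (Z : ℕ → Ω → E) (B : Set E) (ω : Ω) : ℕ∞ :=
  ⨅ (n : ℕ) (_ : a ≤ n ∧ Z n ω ∈ B), (n : ℕ∞)

/-- The expectation of `firstTime`. -/
noncomputable def meanTime {Ω E : Type*} [MeasurableSpace Ω] (m : Measure Ω) (a : ℕ)
    (Z : ℕ → Ω → E) (B : Set E) : ℝ≥0∞ :=
  ∫⁻ ω, ((firstTime a Z B ω : ℕ∞) : ℝ≥0∞) ∂m

/-- Positive recurrence, in the form that makes sense also for a chain that need not be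
irreducible: each state of a closed communicating class has a finite mean return time, and from
each initial state the mean time until such a class is entered is finite. For an irreducible chain
this says that every state is positive recurrent. -/
structure PositiveRecurrent {Ω E : Type*} [MeasurableSpace Ω] (m : Measure Ω) (P : E → PMF E)
    (Z : E → ℕ → Ω → E) : Prop where
  mean_return : ∀ x, Essential P x → meanTime m 1 (Z x) {x} < ∞
  mean_entrance : ∀ x, meanTime m 0 (Z x) {y | Essential P y} < ∞

/-- `ρ` is a stationary distribution. -/
def Stationary {E : Type*} (P : E → PMF E) (ρ : PMF E) : Prop := ρ.bind P = ρ

end Chain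

/-! ### The network -/

/-- `N` mobile stations, and a base station `none : Option (Fin N)`. There are `M` available power
vectors; `S` is the set of topologies. Powers are multiples of a unit `unit > 0`. -/
structure Network (N M : ℕ) (S : Type*) where
  /-- `rate s k i j`: the number of packets that link `(i, j)` can carry in a slot with topology
  `s` under the power vector `k`. -/
  rate : S → Fin M → Fin N → Option (Fin N) → ℕ
  /-- `level k i j`: the power, in units, that station `i` spends on link `(i, j)`. -/
  level : Fin M → Fin N → Option (Fin N) → ℕ
  /-- The bound, in units, on the average power of each station. -/
  budget : Fin N → ℕ
  unit : ℝ
  unit_pos : 0 < unit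
  level_self : ∀ k i, level k i (some i) = 0
  /-- A station transmits to at most one receiver in a slot. -/
  one_receiver : ∀ k i j j', level k i j ≠ 0 → level k i j' ≠ 0 → j = j'
  /-- Without power nothing is transmitted. -/
  rate_eq_zero : ∀ s k i j, level k i j = 0 → rate s k i j = 0

/-- The queues: own queues `X`, relay queues `Y` (in packets), virtual power queues `U` (in units
of power). -/
@[ext] structure QState (N : ℕ) where
  X : Fin N → ℕ
  Y : Fin N → ℕ
  U : Fin N → ℕ

namespace Network

variable {N M : ℕ} {S : Type*}

/-- The packets that leave the own queue of `i` over the link `(i, j)`, when the power vector is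
`k` and `own i` tells whether `i` serves its own queue on the link to the base station. -/
def ownSent (net : Network N M S) (z : QState N) (s : S) (k : Fin M) (own : Fin N → Bool)
    (i : Fin N) : Option (Fin N) → ℕ
  | some j => min (z.X i) (net.rate s k i (some j))
  | none => if own i then min (z.X i) (net.rate s k i none) else 0

/-- The packets that leave the relay queue of `i`, all of them to the base station. -/
def relaySent (net : Network N M S) (z : QState N) (s : S) (k : Fin M) (own : Fin N → Bool)
    (i : Fin N) : ℕ :=
  if own i then 0 else min (z.Y i) (net.rate s k i none)

/-- The queues after a slot with arrivals `a`, topology `s`, power vector `k` and queue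
selection `own`. -/
def step (net : Network N M S) (z : QState N) (a : Fin N → ℕ) (s : S) (k : Fin M)
    (own : Fin N → Bool) : QState N where
  X i := z.X i - ∑ j, net.ownSent z s k own i j + a i
  Y i := z.Y i - net.relaySent z s k own i + ∑ j, net.ownSent z s k own j (some i)
  U i := z.U i - net.budget i + ∑ j, net.level k i j

/-- No more packets leave the own queue than there are: the subtraction in `step` is exact. -/
theorem sum_ownSent_le (net : Network N M S) (z : QState N) (s : S) (k : Fin M)
    (own : Fin N → Bool) (i : Fin N) : ∑ j, net.ownSent z s k own i j ≤ z.X i := by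
  have hle : ∀ j, net.ownSent z s k own i j ≤ z.X i := by
    intro j
    cases j with
    | some j => exact min_le_left _ _
    | none =>
      unfold ownSent
      split_ifs
      · exact min_le_left _ _
      · exact Nat.zero_le _
  have hz : ∀ j, net.level k i j = 0 → net.ownSent z s k own i j = 0 := by
    intro j hj
    cases j with
    | some j => simp [ownSent, net.rate_eq_zero s k i _ hj]
    | none => simp [ownSent, net.rate_eq_zero s k i _ hj]
  by_cases h : ∃ j, net.level k i j ≠ 0
  · obtain ⟨j, hj⟩ := h
    rw [Finset.sum_eq_single j (fun b _ hb => hz b (by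
      by_contra hne
      exact hb (net.one_receiver k i b j hne hj))) (fun h => absurd (Finset.mem_univ j) h)]
    exact hle j
  · push Not at h
    rw [Finset.sum_eq_zero (fun j _ => hz j (h j))]
    exact Nat.zero_le _

/-- The power spent by station `i` under the power vector `k`. -/
noncomputable def power (net : Network N M S) (k : Fin M) (i : Fin N) : ℝ :=
  net.unit * ∑ j, (net.level k i j : ℝ)

/-- The weight of the power vector `k`: differential backlogs times rates, minus virtual queues
times powers (the links from a station to itself have rate zero). -/
noncomputable def weight (net : Network N M S) (z : QState N) (s : S) (k : Fin M) : ℝ :=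
  ∑ i, ((∑ j, ((z.X i : ℝ) - (z.Y j : ℝ)) * (net.rate s k i (some j) : ℝ))
    + max (z.X i : ℝ) (z.Y i : ℝ) * (net.rate s k i none : ℝ)
    - (net.unit * (z.U i : ℝ)) * net.power k i)

/-- A policy that decides from the current queues and the current topology. -/
structure Policy (N M : ℕ) (S : Type*) where
  /-- The power vector. -/
  pow : QState N → S → Fin M
  /-- Whether the own queue (rather than the relay queue) is served on the link to the
  base station. -/
  own : QState N → S → Fin N → Bool

/-- The max-weight policy, with arbitrary tie-breaking: the power vector maximizes the weight, and
the longer one of the own queue and the relay queue is served. -/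
structure IsMaxWeight (net : Network N M S) (Δ : Policy N M S) : Prop where
  pow_max : ∀ z s k, net.weight z s k ≤ net.weight z s (Δ.pow z s)
  own_true : ∀ z s i, Δ.own z s i = true → z.Y i ≤ z.X i
  own_false : ∀ z s i, Δ.own z s i = false → z.X i ≤ z.Y i

/-- One slot under a policy. -/
def next (net : Network N M S) (Δ : Policy N M S) (z : QState N) (a : Fin N → ℕ) (s : S) :
    QState N :=
  net.step z a s (Δ.pow z s) (Δ.own z s)

/-- The queues at the beginning of slot `n`, from the initial queues `z`, with arrivals `A` and
topologies `s`. -/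
def queue {Ω : Type*} (net : Network N M S) (Δ : Policy N M S) (A : ℕ → Ω → Fin N → ℕ)
    (s : ℕ → Ω → S) (z : QState N) : ℕ → Ω → QState N
  | 0, _ => z
  | n + 1, ω => net.next Δ (net.queue Δ A s z n ω) (A n ω) (s n ω)

/-- The law of the queues after one slot, when arrivals and topology are independent with laws
`ν` and `π`. -/
noncomputable def trans (net : Network N M S) (Δ : Policy N M S) (ν : PMF (Fin N → ℕ))
    (π : PMF S) (z : QState N) : PMF (QState N) :=
  ν.bind fun a => π.map fun s => net.next Δ z a s

/-- The average of `g` over the first `T` slots converges almost surely to the constant `c`. -/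
def HasTimeAverage {Ω : Type*} [MeasurableSpace Ω] (m : Measure Ω) (g : ℕ → Ω → ℝ) (c : ℝ) :
    Prop :=
  ∀ᵐ ω ∂m, Tendsto (fun T : ℕ => (∑ n ∈ Finset.range T, g n ω) / (T : ℝ)) atTop (𝓝 c)

/-- The arrival rate vector `lam` is stabilizable under i.i.d. topologies of law `π`: there is a
(possibly randomized and history-dependent, but non-anticipating) policy, choosing power vectors
`k n` and queue selections `own n`, whose long-run average rates exist and for which
* the average service of each own queue exceeds its arrival rate,
* the average service of each relay queue exceeds the average rate at which it is fed,
* the average power of each station is below its bound. -/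
def Stabilizable [MeasurableSpace S] (net : Network N M S) (π : PMF S) (lam : Fin N → ℝ) : Prop :=
  ∃ (Ω : Type) (_ : MeasurableSpace Ω) (m : Measure Ω) (_ : IsProbabilityMeasure m)
    (s : ℕ → Ω → S) (k : ℕ → Ω → Fin M) (own : ℕ → Ω → Fin N → Bool)
    (direct relay pw : Fin N → ℝ) (link : Fin N → Fin N → ℝ),
    (∀ n, Measurable (s n)) ∧ (∀ n, Measurable (k n)) ∧ (∀ n, Measurable (own n)) ∧
    -- the topologies are i.i.d.
    iIndepFun s m ∧ (∀ n, m.map (s n) = π.toMeasure) ∧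
    -- topologies and decisions up to slot `n` are independent of the next topology
    (∀ n, IndepFun (fun ω (t : Fin (n + 1)) => (s t ω, k t ω, own t ω)) (s (n + 1)) m) ∧
    (∀ i j, HasTimeAverage m (fun n ω => (net.rate (s n ω) (k n ω) i (some j) : ℝ)) (link i j)) ∧
    (∀ i, HasTimeAverage m
      (fun n ω => if own n ω i then (net.rate (s n ω) (k n ω) i none : ℝ) else 0) (direct i)) ∧
    (∀ i, HasTimeAverage m
      (fun n ω => if own n ω i then 0 else (net.rate (s n ω) (k n ω) i none : ℝ)) (relay i)) ∧
    (∀ i, HasTimeAverage m (fun n ω => net.power (k n ω) i) (pw i)) ∧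
    (∀ i, lam i < direct i + ∑ j, link i j) ∧
    (∀ i, ∑ j, link j i < relay i) ∧
    (∀ i, pw i < net.unit * (net.budget i : ℝ))

end Network

/-- The arrivals and the topologies are independent over the slots, and in each slot the arrival
vector has law `ν`, the topology has law `π`, and they are independent of each other. -/
structure IsIIDInput {N : ℕ} {S Ω : Type*} [MeasurableSpace S] [MeasurableSpace Ω] (m : Measure Ω)
    (ν : PMF (Fin N → ℕ)) (π : PMF S) (A : ℕ → Ω → Fin N → ℕ) (s : ℕ → Ω → S) : Prop where
  measurable_arrivals : ∀ n, Measurable (A n)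
  measurable_topology : ∀ n, Measurable (s n)
  indep : iIndepFun (fun n ω => (A n ω, s n ω)) m
  law : ∀ n, m.map (fun ω => (A n ω, s n ω)) = ν.toMeasure.prod π.toMeasure

/-! The proof is a Foster–Lyapunov argument for `lyapunov`, the sum of X² + Y² + (unit·U)².
Expanding the squares over one slot (`lyapunov_step_le`) bounds the increment by a constant plus
twice (load − `gain`), where `gain` is linear in the offered rates and powers, with the current
queues as coefficients. Max-weight makes `gain` as large as possible in every topology:
`gain_le_weight` and `IsMaxWeight.gain_eq_weight`.

Stabilizability bounds the maximal weight from below (`Stabilizable.exists_slack`). Fix one sample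
path of the stabilizing policy on which all averages and all topology frequencies converge, and cut
it at a large time T. Its averages up to T still beat the load with slack ε, while the average of
its gain is at most the maximal weight averaged over the empirical topology law. That law is close
to π and weights are O(backlog), so replacing it by π costs at most half of the slack. No stationary
randomized policy has to be constructed. The result is a drift of at most C − 2ε·backlog, with ε now
the remaining slack (`Stabilizable.exists_drift`).

The rest holds for any countable chain with such a drift. Outside a finite set F the drift is at
most −1, and V rises by at most a constant in mean per step, so every set accessible from all states
has finite mean hitting time (`tsum_survive_lt_top`); this gives mean return and entrance times. The
occupation measure of an excursion, normalized, is stationary, and a comparison of two stationary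
laws gives uniqueness on a class. Integrating the drift inequality against a stationary law bounds
the mean backlog (`Stationary.tsum_le`). Finally, the recursively defined queues are linked to the
transition law by independence of the inputs. -/

namespace Chain

/-! ### Hitting times under a drift condition -/

variable {E : Type*}

/-- The expectation of `v` after one step from `x`. -/
noncomputable def avg (P : E → PMF E) (v : E → ℝ≥0∞) (x : E) : ℝ≥0∞ := ∑' y, P x y * v y

theorem avg_mono (P : E → PMF E) {v w : E → ℝ≥0∞} (h : v ≤ w) : avg P v ≤ avg P w :=
  fun _ => ENNReal.tsum_le_tsum fun y => mul_le_mul_right (h y) _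

theorem avg_add (P : E → PMF E) (v w : E → ℝ≥0∞) (x : E) :
    avg P (fun y => v y + w y) x = avg P v x + avg P w x := by
  simp only [avg, mul_add, ENNReal.tsum_add]

theorem avg_const (P : E → PMF E) (c : ℝ≥0∞) (x : E) : avg P (fun _ => c) x = c := by
  simp only [avg, ENNReal.tsum_mul_right, PMF.tsum_coe, one_mul]

/-- One step of the chain that is killed when it jumps to `B`. -/
noncomputable def killed (P : E → PMF E) (B : Set E) (v : E → ℝ≥0∞) : E → ℝ≥0∞ :=
  avg P (Bᶜ.indicator v)

theorem killed_le_avg (P : E → PMF E) (B : Set E) (v : E → ℝ≥0∞) : killed P B v ≤ avg P v :=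
  avg_mono P (Set.indicator_le_self _ _)

theorem killed_mono (P : E → PMF E) (B : Set E) {v w : E → ℝ≥0∞} (h : v ≤ w) :
    killed P B v ≤ killed P B w :=
  avg_mono P fun _ => Set.indicator_le_indicator (h _)

theorem killed_add (P : E → PMF E) (B : Set E) (v w : E → ℝ≥0∞) :
    killed P B (v + w) = killed P B v + killed P B w := by
  funext x
  simp only [killed, Set.indicator_add', Pi.add_apply]
  exact avg_add P _ _ x

theorem killed_smul (P : E → PMF E) (B : Set E) (c : ℝ≥0∞) (v : E → ℝ≥0∞) :
    killed P B (c • v) = c • killed P B v := by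
  funext x
  simp only [killed, avg, Pi.smul_apply, smul_eq_mul, ← ENNReal.tsum_mul_left]
  refine tsum_congr fun y => ?_
  by_cases hy : y ∈ Bᶜ
  · simp [hy, mul_left_comm]
  · simp [hy]

theorem killed_const_le (P : E → PMF E) (B : Set E) (c : ℝ≥0∞) :
    killed P B (fun _ => c) ≤ fun _ => c := fun x =>
  (killed_le_avg P B _ x).trans (avg_const P c x).le

/-- The probability to avoid `B` in the steps `1, …, n`. -/
noncomputable def survive (P : E → PMF E) (B : Set E) : ℕ → E → ℝ≥0∞
  | 0 => 1
  | n + 1 => killed P B (survive P B n)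

theorem survive_le_one (P : E → PMF E) (B : Set E) (n : ℕ) : survive P B n ≤ 1 := by
  induction n with
  | zero => exact le_rfl
  | succ n ih => exact (killed_mono P B ih).trans (killed_const_le P B 1)

/-- The expectation of the time of the first visit to `B` after time `0`, truncated at `n`. -/
noncomputable def truncTime (P : E → PMF E) (B : Set E) (n : ℕ) (x : E) : ℝ≥0∞ :=
  ∑ j ∈ Finset.range n, survive P B j x

theorem truncTime_succ (P : E → PMF E) (B : Set E) (n : ℕ) :
    truncTime P B (n + 1) = 1 + killed P B (truncTime P B n) := by
  induction n with
  | zero =>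
    have h : truncTime P B 0 = 0 := by
      funext x
      simp [truncTime]
    funext x
    simp [h, killed, avg]
    simp [truncTime, survive]
  | succ n ih =>
    have h : ∀ k, truncTime P B (k + 1) = truncTime P B k + survive P B k := fun k => by
      funext x
      simp [truncTime, Finset.sum_range_succ]
    rw [h (n + 1)]
    conv_lhs => rw [ih]
    rw [h n, killed_add, add_assoc]
    rfl

theorem truncTime_mono (P : E → PMF E) (B : Set E) : Monotone (truncTime P B) :=
  fun _ _ h _ => Finset.sum_le_sum_of_subset (Finset.range_mono h)

theorem truncTime_le (P : E → PMF E) (B : Set E) (n : ℕ) (x : E) : truncTime P B n x ≤ n := by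
  refine (Finset.sum_le_sum fun j _ => survive_le_one P B j x).trans ?_
  simp

/-- The first k steps count for at most k; the remaining time is restarted from the position after k
killed steps. -/
theorem truncTime_add_le (P : E → PMF E) (B : Set E) (n k : ℕ) :
    truncTime P B (n + k) ≤ (fun _ => (k : ℝ≥0∞)) + (killed P B)^[k] (truncTime P B n) := by
  induction k with
  | zero => intro x; simp
  | succ k ih =>
    rw [← add_assoc, truncTime_succ, Function.iterate_succ_apply']
    have h := killed_mono P B ih
    rw [killed_add] at h
    intro x
    have h1 := h x
    have h2 := killed_const_le P B (k : ℝ≥0∞) x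
    simp only [Pi.add_apply, Pi.one_apply, Nat.cast_add, Nat.cast_one] at *
    calc 1 + killed P B (truncTime P B (n + k)) x
        ≤ 1 + (k + killed P B ((killed P B)^[k] (truncTime P B n)) x) := by gcongr; exact h1.trans (by gcongr)
      _ = _ := by ring

/-- Killing only lowers the mean of V, which gains at most C per step, whereas the constant c is
collected only on survival. The factor `survive` is what later produces a contraction. -/
theorem iterate_killed_le (P : E → PMF E) (B : Set E) {V : E → ℝ≥0∞} {C : ℝ≥0∞}
    (hdrift : ∀ x, avg P V x ≤ V x + C) (c : ℝ≥0∞) (k : ℕ) (x : E) :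
    (killed P B)^[k] (V + c • (1 : E → ℝ≥0∞)) x ≤ V x + k * C + c * survive P B k x := by
  have h1 : ∀ k, (killed P B)^[k] (V + c • (1 : E → ℝ≥0∞)) ≤
      (V + fun _ => k * C) + c • survive P B k := by
    intro k
    induction k with
    | zero => intro x; simp [survive]
    | succ k ih =>
      rw [Function.iterate_succ_apply']
      refine (killed_mono P B ih).trans ?_
      rw [killed_add, killed_smul, killed_add]
      intro x
      have h2 := (killed_le_avg P B V x).trans (hdrift x)
      have h3 := killed_const_le P B (k * C) x
      simp only [Pi.add_apply, Nat.cast_add, Nat.cast_one, Pi.smul_apply, smul_eq_mul, survive]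
      refine add_le_add ?_ le_rfl
      calc _ ≤ V x + C + k * C := add_le_add h2 h3
        _ = _ := by ring
  exact h1 k x

/-- If `B` can be reached from everywhere, it is hit with positive probability. -/
theorem exists_survive_lt_one {P : E → PMF E} {B : Set E} (hB : ∀ x, ∃ b ∈ B, Reach P x b)
    (x : E) : ∃ k, survive P B k x < 1 := by
  by_contra! hx
  -- Sure survival is inherited by every successor: a successor in B, or one with a positive chance
  -- to hit B, would make an average of numbers at most 1 strictly smaller than 1.
  have hstep : ∀ z, (∀ k, 1 ≤ survive P B k z) → ∀ y, P z y ≠ 0 →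
      y ∉ B ∧ ∀ k, 1 ≤ survive P B k y := by
    intro z hz y hy
    have key : ∀ k, 1 ≤ Bᶜ.indicator (survive P B k) y := by
      intro k
      by_contra! hlt
      have hle : ∀ w, P z w * Bᶜ.indicator (survive P B k) w ≤ P z w := fun w =>
        mul_le_of_le_one_right' ((Set.indicator_le_self _ _ _).trans (survive_le_one P B k w))
      have h2 : ∑' w, P z w * Bᶜ.indicator (survive P B k) w < ∑' w, P z w := by
        refine ENNReal.tsum_lt_tsum (i := y) ?_ hle ?_
        · exact ne_top_of_le_ne_top (PMF.tsum_coe_ne_top (P z)) (ENNReal.tsum_le_tsum hle)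
        · calc _ < P z y * 1 := by
                gcongr
                exact (P z).apply_ne_top y
            _ = _ := mul_one _
      rw [PMF.tsum_coe] at h2
      exact absurd (hz (k + 1)) (not_le.2 h2)
    have hyB : y ∉ B := fun h => by simpa [h] using key 0
    refine ⟨hyB, fun k => ?_⟩
    simpa [hyB] using key k
  -- `survive` ignores time 0, so x itself may lie in B; the path to B is therefore taken from a
  -- successor of x.
  obtain ⟨y, hy⟩ := (P x).support_nonempty
  obtain ⟨b, hb, hr⟩ := hB y
  have hgood : ∀ b, Reach P y b → b ∉ B ∧ ∀ k, 1 ≤ survive P B k b := by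
    intro b hr
    induction hr with
    | refl => exact hstep x hx y hy
    | tail _ h ih => exact hstep _ ih.2 _ h
  exact (hgood b hr).1 hb

/-- Outside F each step costs 1 and is paid for by the decrease of V; on F the supremum is a trivial
bound. Only the finitely many values on F remain to be controlled. -/
theorem truncTime_le_add_sup {P : E → PMF E} {B : Set E} {V : E → ℝ≥0∞} {F : Finset E}
    (hdrift : ∀ x, x ∉ F → avg P V x + 1 ≤ V x) (n : ℕ) :
    truncTime P B n ≤ V + F.sup (truncTime P B n) • (1 : E → ℝ≥0∞) := by
  induction n with
  | zero => intro x; simp [truncTime]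
  | succ n ih =>
    intro x
    simp only [Pi.add_apply, Pi.smul_apply, Pi.one_apply, smul_eq_mul, mul_one]
    by_cases hx : x ∈ F
    · exact (Finset.le_sup (f := truncTime P B (n + 1)) hx).trans le_add_self
    · have h1 := ((killed_le_avg P B _).trans (avg_mono P ih)) x
      have h2 : avg P (V + F.sup (truncTime P B n) • (1 : E → ℝ≥0∞)) x =
          avg P V x + F.sup (truncTime P B n) := by
        have hfun : V + F.sup (truncTime P B n) • (1 : E → ℝ≥0∞) =
            fun y => V y + (fun _ => F.sup (truncTime P B n)) y := by
          funext y
          simp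
        rw [hfun, avg_add, avg_const]
      have h3 : F.sup (truncTime P B n) ≤ F.sup (truncTime P B (n + 1)) :=
        Finset.sup_mono_fun fun y _ => truncTime_mono P B n.le_succ y
      calc truncTime P B (n + 1) x
          = 1 + killed P B (truncTime P B n) x := congrFun (truncTime_succ P B n) x
        _ ≤ 1 + (avg P V x + F.sup (truncTime P B n)) := by
            gcongr
            exact h1.trans h2.le
        _ = (avg P V x + 1) + F.sup (truncTime P B n) := by ring
        _ ≤ _ := add_le_add (hdrift x hx) h3

/-- Under a drift condition, the mean time until the next visit to `B` is finite for each set `B`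
that can be reached from everywhere. -/
theorem tsum_survive_lt_top {P : E → PMF E} {B : Set E} {V : E → ℝ≥0∞} (hV : ∀ x, V x ≠ ∞)
    {C : ℝ≥0∞} (hC : C ≠ ∞) {F : Finset E} (hbound : ∀ x, avg P V x ≤ V x + C)
    (hdrift : ∀ x, x ∉ F → avg P V x + 1 ≤ V x) (hB : ∀ x, ∃ b ∈ B, Reach P x b) (x : E) :
    ∑' n, survive P B n x < ∞ := by
  choose k hk using exists_survive_lt_one hB
  set p : E → ℝ≥0∞ := fun y => survive P B (k y) y
  -- The cost of one attempt from y: k y steps, plus the bound on the mean of V after them. With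
  -- probability at least 1 − p y the attempt hits B.
  set D : E → ℝ≥0∞ := fun y => k y + (V y + k y * C)
  have hD : ∀ y, D y ≠ ∞ := fun y => by
    simp [D, hV y, ENNReal.mul_eq_top, hC]
  set q : ℝ≥0∞ := F.sup p
  set d : ℝ≥0∞ := F.sup D
  have hq : q < 1 := (Finset.sup_lt_iff (by simp)).2 fun y _ => hk y
  have hd : d < ∞ := (Finset.sup_lt_iff (by simp)).2 fun y _ => (hD y).lt_top
  have hsup : ∀ n, F.sup (truncTime P B n) ≤ d / (1 - q) := by
    intro n
    set H := F.sup (truncTime P B n)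
    -- Truncation at n is there to make H finite, so that H ≤ d + q·H can be solved for H with a
    -- bound independent of n.
    have hH : H < ∞ := (Finset.sup_lt_iff (by simp)).2 fun y _ =>
      (truncTime_le P B n y).trans_lt (by simp)
    have h1 : H ≤ d + q * H := by
      refine Finset.sup_le fun y hy => ?_
      have hmono : Monotone (killed P B) := fun _ _ h => killed_mono P B h
      calc truncTime P B n y ≤ truncTime P B (n + k y) y := truncTime_mono P B (by simp) y
        _ ≤ k y + (killed P B)^[k y] (truncTime P B n) y := truncTime_add_le P B n (k y) y
        _ ≤ k y + (V y + k y * C + H * p y) := by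
          gcongr
          exact (hmono.iterate _ (truncTime_le_add_sup hdrift n) y).trans
            (iterate_killed_le P B hbound H (k y) y)
        _ = D y + p y * H := by simp only [D]; ring
        _ ≤ d + q * H := by
          gcongr
          · exact Finset.le_sup (f := D) hy
          · exact Finset.le_sup (f := p) hy
    have hq0 : 1 - q ≠ 0 := (tsub_pos_of_lt hq).ne'
    rw [ENNReal.le_div_iff_mul_le (Or.inl hq0) (Or.inl (by simp)), mul_comm,
      ENNReal.sub_mul (fun _ _ => hH.ne), one_mul]
    exact tsub_le_iff_right.2 h1
  refine lt_of_le_of_lt (b := V x + d / (1 - q)) ?_ ?_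
  · rw [ENNReal.tsum_eq_iSup_nat]
    refine iSup_le fun n => (truncTime_le_add_sup hdrift n x).trans ?_
    simpa using add_le_add le_rfl (hsup n)
  · exact ENNReal.add_lt_top.2 ⟨(hV x).lt_top, ENNReal.div_lt_top hd.ne (tsub_pos_of_lt hq).ne'⟩

/-! ### Essential states -/

/-- From each state the chain reaches the finite set outside which the drift is negative. -/
theorem exists_reach_of_drift {P : E → PMF E} {V : E → ℝ≥0∞} (hV : ∀ x, V x ≠ ∞) {F : Finset E}
    (hdrift : ∀ x, x ∉ F → avg P V x + 1 ≤ V x) (x : E) : ∃ y ∈ F, Reach P x y := by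
  by_contra! hx
  -- If F is never reached, V loses at least 1 in mean at every step while staying nonnegative,
  -- which forces it above every n.
  have key : ∀ n : ℕ, ∀ x, (∀ y ∈ F, ¬ Reach P x y) → (n : ℝ≥0∞) ≤ V x := by
    intro n
    induction n with
    | zero => simp
    | succ n ih =>
      intro x hx
      have hxF : x ∉ F := fun h => hx x h Relation.ReflTransGen.refl
      refine le_trans ?_ (hdrift x hxF)
      rw [Nat.cast_add, Nat.cast_one]
      gcongr
      rw [← avg_const P (n : ℝ≥0∞) x]
      refine ENNReal.tsum_le_tsum fun y => ?_
      by_cases hy : P x y = 0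
      · simp [hy]
      · gcongr
        exact ih y fun w hw hr => hx w hw (Relation.ReflTransGen.head hy hr)
  obtain ⟨n, hn⟩ := ENNReal.exists_nat_gt (hV x)
  exact absurd (key n x hx) (not_le.2 hn)

/-- Among the states of F reachable from x, take one that leads to the fewest states of F. Any state
reached from it leads back into F, and by minimality that state of F still leads to all the same
states of F, including the chosen one. -/
theorem exists_essential {P : E → PMF E} {F : Finset E} (hF : ∀ x, ∃ y ∈ F, Reach P x y) (x : E) :
    ∃ y ∈ {y | Essential P y}, Reach P x y := by
  classical
  obtain ⟨y₀, hy₀, hr₀⟩ := hF x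
  obtain ⟨y, hy, hmin⟩ := Finset.exists_min_image (F.filter (Reach P x))
    (fun y => (F.filter (Reach P y)).card) ⟨y₀, by simp [hy₀, hr₀]⟩
  obtain ⟨hyF, hxy⟩ := Finset.mem_filter.1 hy
  refine ⟨y, fun z hz => ?_, hxy⟩
  obtain ⟨w, hw, hzw⟩ := hF z
  have hyw : Reach P y w := hz.trans hzw
  have hsub : F.filter (Reach P w) ⊆ F.filter (Reach P y) := fun v hv => by
    rw [Finset.mem_filter] at hv ⊢
    exact ⟨hv.1, hyw.trans hv.2⟩
  have heq := Finset.eq_of_subset_of_card_le hsub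
    (hmin w (Finset.mem_filter.2 ⟨hw, hxy.trans hyw⟩))
  have hmem : y ∈ F.filter (Reach P y) := Finset.mem_filter.2 ⟨hyF, Relation.ReflTransGen.refl⟩
  rw [← heq] at hmem
  exact hzw.trans (Finset.mem_filter.1 hmem).2

theorem survive_congr {P : E → PMF E} {B B' : Set E} {x : E}
    (h : ∀ y, Reach P x y → (y ∈ B ↔ y ∈ B')) (n : ℕ) {y : E} (hy : Reach P x y) :
    survive P B n y = survive P B' n y := by
  induction n generalizing y with
  | zero => rfl
  | succ n ih =>
    refine tsum_congr fun z => ?_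
    by_cases hz : P y z = 0
    · simp [hz]
    · have hr : Reach P x z := hy.tail hz
      congr 1
      by_cases hB : z ∈ B
      · simp [hB, (h z hr).1 hB]
      · have hB' : z ∉ B' := fun h' => hB ((h z hr).2 h')
        simp [hB, hB', ih hr]

/-- Under a drift condition, essential states have finite mean return times. -/
theorem tsum_survive_singleton_lt_top {P : E → PMF E} {V : E → ℝ≥0∞} (hV : ∀ x, V x ≠ ∞)
    {C : ℝ≥0∞} (hC : C ≠ ∞) {F : Finset E} (hbound : ∀ x, avg P V x ≤ V x + C)
    (hdrift : ∀ x, x ∉ F → avg P V x + 1 ≤ V x) {x : E} (hx : Essential P x) :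
    ∑' n, survive P {x} n x < ∞ := by
  -- Adding the states unreachable from x makes the target accessible from everywhere, and does not
  -- change hitting times for the chain started in x.
  have h := tsum_survive_lt_top (B := {x} ∪ {y | ¬ Reach P x y}) hV hC hbound hdrift (fun y => by
    by_cases hy : Reach P x y
    · exact ⟨x, Or.inl rfl, hx y hy⟩
    · exact ⟨y, Or.inr hy, Relation.ReflTransGen.refl⟩) x
  refine lt_of_eq_of_lt (tsum_congr fun n => ?_) h
  refine survive_congr (x := x) (fun y hy => ?_) n Relation.ReflTransGen.refl
  simp [hy]

/-! ### Excursions and stationary distributions -/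

/-- The probability that the chain started in `x` avoids `B` in the steps `1, …, n` and is in `y`
after `n` steps. -/
noncomputable def excursion (P : E → PMF E) (B : Set E) (x : E) : ℕ → E → ℝ≥0∞
  | 0 => ({x} : Set E).indicator 1
  | n + 1 => Bᶜ.indicator fun y => ∑' z, excursion P B x n z * P z y

/-- Avoiding B for n + k steps is split according to the position at time n; the induction moves one
step from one factor to the other. -/
theorem tsum_excursion_mul_survive (P : E → PMF E) (B : Set E) (x : E) (n k : ℕ) :
    ∑' y, excursion P B x n y * survive P B k y = survive P B (n + k) x := by
  induction n generalizing k with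
  | zero =>
    rw [tsum_eq_single x]
    · simp [excursion]
    · intro y hy
      simp [excursion, hy]
  | succ n ih =>
    rw [add_assoc, add_comm 1 k, ← ih (k + 1)]
    simp only [survive, killed, avg, ← ENNReal.tsum_mul_left]
    rw [ENNReal.tsum_comm]
    refine tsum_congr fun y => ?_
    by_cases hy : y ∈ B
    · simp [excursion, hy]
    · simp [excursion, hy, ← ENNReal.tsum_mul_right, mul_assoc]

theorem tsum_excursion (P : E → PMF E) (B : Set E) (x : E) (n : ℕ) :
    ∑' y, excursion P B x n y = survive P B n x := by
  simpa [survive] using tsum_excursion_mul_survive P B x n 0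

theorem reach_of_excursion_ne_zero {P : E → PMF E} {B : Set E} {x y : E} {n : ℕ}
    (h : excursion P B x n y ≠ 0) : Reach P x y := by
  induction n generalizing y with
  | zero =>
    by_cases hy : y = x
    · subst hy; exact Relation.ReflTransGen.refl
    · simp [excursion, hy] at h
  | succ n ih =>
    have h' : ∑' z, excursion P B x n z * P z y ≠ 0 := fun h0 => h (by
      by_cases hy : y ∈ B <;> simp [excursion, hy, h0])
    obtain ⟨z, hz⟩ : ∃ z, excursion P B x n z * P z y ≠ 0 := by
      by_contra! hall
      exact h' (by simp [hall])
    exact (ih (left_ne_zero_of_mul hz)).tail (right_ne_zero_of_mul hz)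

/-- The occupation measure of an excursion from `x` is invariant. -/
theorem tsum_excursion_invariant {P : E → PMF E} {x : E} (hx : ∑' n, survive P {x} n x ≠ ∞)
    (y : E) :
    ∑' z, (∑' n, excursion P {x} x n z) * P z y = ∑' n, excursion P {x} x n y := by
  set g : E → ℝ≥0∞ := fun z => ∑' n, excursion P {x} x n z
  have hsum : ∑' z, g z = ∑' n, survive P {x} n x := by
    simp only [g]
    rw [ENNReal.tsum_comm]
    exact tsum_congr fun n => tsum_excursion P {x} x n
  -- Away from x one step of P just shifts the time index, and the time-0 term vanishes.
  have hoff : ∀ y, y ≠ x → ∑' z, g z * P z y = g y := by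
    intro y hy
    simp only [g, ← ENNReal.tsum_mul_right]
    rw [ENNReal.tsum_comm, tsum_eq_zero_add' (f := fun n => excursion P {x} x n y)
      ENNReal.summable]
    simp [excursion, hy]
  by_cases hy : y = x
  · subst hy
    -- At x itself the balance follows from conservation of total mass: the mass off x is already
    -- balanced, and it is finite, so it can be cancelled.
    have htot : ∑' w, ∑' z, g z * P z w = ∑' w, g w := by
      rw [ENNReal.tsum_comm]
      simp [ENNReal.tsum_mul_left]
    classical
    rw [ENNReal.tsum_eq_add_tsum_ite (f := fun w => ∑' z, g z * P z w) y,
      ENNReal.tsum_eq_add_tsum_ite (f := g) y] at htot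
    have hrest : ∑' w, (if w = y then 0 else ∑' z, g z * P z w) =
        ∑' w, if w = y then 0 else g w :=
      tsum_congr fun w => by
        by_cases hw : w = y
        · simp [hw]
        · simp [hw, hoff w hw]
    rw [hrest] at htot
    refine (ENNReal.add_left_inj ?_).1 htot
    refine ne_top_of_le_ne_top (hsum ▸ hx) (ENNReal.tsum_le_tsum fun w => ?_)
    split_ifs <;> simp
  · exact hoff y hy

theorem stationary_iff {P : E → PMF E} {ρ : PMF E} :
    Stationary P ρ ↔ ∀ y, ∑' z, ρ z * P z y = ρ y := by
  rw [Stationary, PMF.ext_iff]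
  rfl

theorem exists_stationary {P : E → PMF E} {x : E} (hx : ∑' n, survive P {x} n x ≠ ∞) :
    ∃ ρ : PMF E, Stationary P ρ ∧ ∀ y ∈ ρ.support, Reach P x y := by
  set g : E → ℝ≥0∞ := fun z => ∑' n, excursion P {x} x n z
  have hsum : ∑' z, g z = ∑' n, survive P {x} n x := by
    simp only [g]
    rw [ENNReal.tsum_comm]
    exact tsum_congr fun n => tsum_excursion P {x} x n
  have h0 : ∑' z, g z ≠ 0 := by
    rw [hsum]
    refine ne_of_gt (lt_of_lt_of_le ?_ (ENNReal.le_tsum 0))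
    simp [survive]
  refine ⟨PMF.normalize g h0 (hsum ▸ hx), stationary_iff.2 fun y => ?_, fun y hy => ?_⟩
  · simp only [PMF.normalize_apply]
    rw [← show ∑' z, g z * P z y = g y from tsum_excursion_invariant hx y,
      ← ENNReal.tsum_mul_right]
    exact tsum_congr fun z => by ring
  · have hy' : g y ≠ 0 := by
      rw [PMF.mem_support_iff, PMF.normalize_apply] at hy
      exact left_ne_zero_of_mul hy
    obtain ⟨n, hn⟩ : ∃ n, excursion P {x} x n y ≠ 0 := by
      by_contra! hall
      exact hy' (by simp [g, hall])
    exact reach_of_excursion_ne_zero hn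

/-- Two stationary distributions of a closed class such that one is below the other in some state
of the class are equal. -/
theorem Stationary.eq_of_le {P : E → PMF E} {ρ σ : PMF E} {x y : E} (hx : Essential P x)
    (hρ : Stationary P ρ) (hσ : Stationary P σ) (hρx : ∀ y ∈ ρ.support, Reach P x y)
    (hxy : Reach P x y) (hle : ρ y ≤ σ y) : ρ = σ := by
  rw [stationary_iff] at hρ hσ
  -- The minimum of two invariant measures is subinvariant; as its mass is finite and preserved, it
  -- is invariant. Hence so is the excess `d` of ρ over σ (truncated subtraction).
  set κ : E → ℝ≥0∞ := fun z => min (ρ z) (σ z)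
  set d : E → ℝ≥0∞ := fun z => ρ z - σ z
  have hκ1 : ∑' z, κ z ≠ ∞ :=
    ne_top_of_le_ne_top ρ.tsum_coe_ne_top (ENNReal.tsum_le_tsum fun z => min_le_left _ _)
  have hadd : ∀ z, κ z + d z = ρ z := by
    intro z
    rcases le_total (ρ z) (σ z) with h | h
    · simp [κ, d, h, tsub_eq_zero_of_le h]
    · simp [κ, d, h, add_tsub_cancel_of_le h]
  have hκle : ∀ z, ∑' w, κ w * P w z ≤ κ z := fun z => le_min
    ((ENNReal.tsum_le_tsum fun w => by gcongr; exact min_le_left _ _).trans (hρ z).le)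
    ((ENNReal.tsum_le_tsum fun w => by gcongr; exact min_le_right _ _).trans (hσ z).le)
  have hκtot : ∑' z, ∑' w, κ w * P w z = ∑' z, κ z := by
    rw [ENNReal.tsum_comm]
    simp [ENNReal.tsum_mul_left]
  have hκ : ∀ z, ∑' w, κ w * P w z = κ z := by
    intro z
    by_contra hne
    exact (ENNReal.tsum_lt_tsum (hκtot ▸ hκ1) hκle (lt_of_le_of_ne (hκle z) hne)).ne hκtot
  have hd : ∀ z, ∑' w, d w * P w z = d z := by
    intro z
    have h := hρ z
    simp only [← hadd, add_mul, ENNReal.tsum_add] at h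
    rw [hκ z] at h
    exact (ENNReal.add_right_inj (ne_top_of_le_ne_top hκ1 (ENNReal.le_tsum z))).1 h
  -- A zero of an invariant measure propagates backwards along transitions. Since d y = 0, and every
  -- state charged by ρ leads to y, this gives ρ ≤ σ, hence equality of the two probability laws.
  have hzero : ∀ z, Reach P z y → d z = 0 := by
    intro z hz
    induction hz using Relation.ReflTransGen.head_induction_on with
    | refl => exact tsub_eq_zero_of_le hle
    | head hstep _ ih =>
      rename_i a c _
      have h : d a * P a c = 0 :=
        le_antisymm ((ENNReal.le_tsum (f := fun w => d w * P w c) a).trans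
          ((hd c).trans ih).le) bot_le
      exact (mul_eq_zero.1 h).resolve_right hstep
  have hle' : ∀ z, ρ z ≤ σ z := by
    intro z
    by_cases hz : ρ z = 0
    · simp [hz]
    · exact tsub_eq_zero_iff_le.1 (hzero z ((hx z (hρx z hz)).trans hxy))
  refine PMF.ext fun z => ?_
  by_contra hne
  have := ENNReal.tsum_lt_tsum ρ.tsum_coe_ne_top hle' (lt_of_le_of_ne (hle' z) hne)
  simp [PMF.tsum_coe] at this

theorem existsUnique_stationary {P : E → PMF E} {x : E} (hx : Essential P x)
    (hfin : ∑' n, survive P {x} n x ≠ ∞) :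
    ∃! ρ : PMF E, Stationary P ρ ∧ ∀ y ∈ ρ.support, Reach P x y := by
  obtain ⟨ρ, hρ, hρx⟩ := exists_stationary hfin
  refine ⟨ρ, ⟨hρ, hρx⟩, fun σ ⟨hσ, hσx⟩ => ?_⟩
  rcases le_total (σ x) (ρ x) with h | h
  · exact hσ.eq_of_le hx hρ hσx Relation.ReflTransGen.refl h
  · exact (hρ.eq_of_le hx hσ hρx Relation.ReflTransGen.refl h).symm

/-- Under a drift condition, the moment `f` of each stationary distribution is finite. -/
theorem Stationary.tsum_le {P : E → PMF E} {ρ : PMF E} (hρ : Stationary P ρ) {V f : E → ℝ≥0∞}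
    (hV : ∀ x, V x ≠ ∞) {C : ℝ≥0∞} (hdrift : ∀ x, avg P V x + f x ≤ V x + C) :
    ∑' x, ρ x * f x ≤ C := by
  rw [stationary_iff] at hρ
  -- V need not be ρ-integrable, so its two means cannot be cancelled directly. The bounded function
  -- min(V, c) still satisfies the drift inequality, with f kept only where V ≤ c.
  have htrunc : ∀ c : ℝ≥0∞, c ≠ ∞ → ∑' x, ρ x * {x | V x ≤ c}.indicator f x ≤ C := by
    intro c hc
    have hpt : ∀ x, avg P (fun y => min (V y) c) x + {x | V x ≤ c}.indicator f x
        ≤ min (V x) c + C := by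
      intro x
      by_cases hx : V x ≤ c
      · have hmem : x ∈ {x | V x ≤ c} := hx
        rw [Set.indicator_of_mem hmem, min_eq_left hx]
        refine le_trans ?_ (hdrift x)
        gcongr
        exact avg_mono P (fun y => min_le_left _ _) x
      · have hmem : x ∉ {x | V x ≤ c} := hx
        rw [Set.indicator_of_notMem hmem, min_eq_right (not_le.1 hx).le, add_zero]
        refine le_trans ?_ le_self_add
        exact (avg_mono P (w := fun _ => c) (fun y => min_le_right _ _) x).trans
          (avg_const P c x).le
    have hinv : ∑' x, ρ x * avg P (fun y => min (V y) c) x = ∑' x, ρ x * min (V x) c := by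
      simp only [avg, ← ENNReal.tsum_mul_left, ← mul_assoc]
      rw [ENNReal.tsum_comm]
      simp only [ENNReal.tsum_mul_right, hρ]
    have hfin : ∑' x, ρ x * min (V x) c ≠ ∞ := by
      refine ne_top_of_le_ne_top hc ?_
      calc _ ≤ ∑' x, ρ x * c := ENNReal.tsum_le_tsum fun x => by gcongr; exact min_le_right _ _
        _ = c := by simp [ENNReal.tsum_mul_right]
    have h := ENNReal.tsum_le_tsum fun x => mul_le_mul_right (hpt x) (ρ x)
    simp only [mul_add, ENNReal.tsum_add, hinv, ENNReal.tsum_mul_right, PMF.tsum_coe,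
      one_mul] at h
    exact (ENNReal.add_le_add_iff_left hfin).1 h
  rw [ENNReal.tsum_eq_iSup_sum]
  refine iSup_le fun T => ?_
  refine le_trans ?_ (htrunc (T.sup V)
    ((Finset.sup_lt_iff (by simp)).2 fun y _ => (hV y).lt_top).ne)
  refine le_trans (Finset.sum_le_sum fun x hx => ?_) (ENNReal.sum_le_tsum T)
  have hmem : x ∈ {x | V x ≤ T.sup V} := Finset.le_sup (f := V) hx
  rw [Set.indicator_of_mem hmem]

/-! ### Chains driven by independent inputs -/

section Driven

variable {Ω I E : Type*} {W : ℕ → Ω → I} {P : E → PMF E} {Φ : E → I → E} {x : E} {Z : ℕ → Ω → E}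

/-- `H` is determined by the inputs before time `n`. -/
def IsHistory (W : ℕ → Ω → I) (n : ℕ) (H : Set Ω) : Prop :=
  ∀ ω ω', (∀ k < n, W k ω = W k ω') → ω ∈ H → ω' ∈ H

/-- This form makes histories measurable and independent of the next input: finite tuples of inputs
from a countable set form a countable space, in which all sets are measurable. -/
theorem IsHistory.eq_preimage {n : ℕ} {H : Set Ω} (hH : IsHistory W n H) :
    H = (fun ω (k : Finset.range n) => W k ω) ⁻¹' ((fun ω (k : Finset.range n) => W k ω) '' H) := by
  refine Set.Subset.antisymm (Set.subset_preimage_image _ _) ?_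
  rintro ω' ⟨ω, hω, h⟩
  exact hH ω ω' (fun k hk => congrFun h ⟨k, Finset.mem_range.2 hk⟩) hω

theorem eq_of_inputs_eq (h0 : ∀ ω, Z 0 ω = x) (hstep : ∀ n ω, Z (n + 1) ω = Φ (Z n ω) (W n ω))
    {n : ℕ} {ω ω' : Ω} (h : ∀ k < n, W k ω = W k ω') {k : ℕ} (hk : k ≤ n) : Z k ω = Z k ω' := by
  induction k with
  | zero => rw [h0, h0]
  | succ k ih => rw [hstep, hstep, ih (by omega), h k (by omega)]

variable [MeasurableSpace Ω] {m : Measure Ω} [MeasurableSpace I] [Countable I]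
  [MeasurableSingletonClass I]

theorem IsHistory.measurableSet (hW : ∀ n, Measurable (W n)) {n : ℕ} {H : Set Ω}
    (hH : IsHistory W n H) : MeasurableSet H := by
  rw [hH.eq_preimage]
  have hmeas : Measurable fun ω (k : Finset.range n) => W k ω :=
    measurable_pi_lambda _ fun k => hW k
  exact hmeas (Set.to_countable _).measurableSet

theorem IsHistory.measure_inter (hW : ∀ n, Measurable (W n)) (hind : iIndepFun W m) {n : ℕ}
    {H : Set Ω} (hH : IsHistory W n H) (T : Set I) :
    m (H ∩ W n ⁻¹' T) = m H * m (W n ⁻¹' T) := by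
  have h := hind.indepFun_finset (Finset.range n) {n} (by simp) hW
  have h' := h.measure_inter_preimage_eq_mul
    ((fun ω (k : Finset.range n) => W k ω) '' H) {f | f ⟨n, by simp⟩ ∈ T}
    (Set.to_countable _).measurableSet (Set.to_countable _).measurableSet
  rw [← hH.eq_preimage] at h'
  exact h'

/-- The Markov property, relative to the events determined by the inputs so far. -/
theorem measure_history_inter (hW : ∀ n, Measurable (W n)) (hind : iIndepFun W m)
    (h0 : ∀ ω, Z 0 ω = x) (hstep : ∀ n ω, Z (n + 1) ω = Φ (Z n ω) (W n ω))
    (hlaw : ∀ n z y, m {ω | Φ z (W n ω) = y} = P z y) {n : ℕ} {H : Set Ω}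
    (hH : IsHistory W n H) (z y : E) :
    m ((H ∩ {ω | Z n ω = z}) ∩ {ω | Z (n + 1) ω = y}) = m (H ∩ {ω | Z n ω = z}) * P z y := by
  have hH' : IsHistory W n (H ∩ {ω | Z n ω = z}) := fun ω ω' h hω =>
    ⟨hH ω ω' h hω.1, (eq_of_inputs_eq h0 hstep h le_rfl).symm.trans hω.2⟩
  rw [← hlaw n z y]
  refine Eq.trans ?_ (hH'.measure_inter hW hind {i | Φ z i = y})
  congr 1
  ext ω
  constructor
  · rintro ⟨⟨h1, h2⟩, h3⟩
    refine ⟨⟨h1, h2⟩, ?_⟩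
    simp only [Set.mem_ofPred_eq, Set.mem_preimage] at *
    rw [← h3, hstep, h2]
  · rintro ⟨⟨h1, h2⟩, h3⟩
    refine ⟨⟨h1, h2⟩, ?_⟩
    simp only [Set.mem_ofPred_eq, Set.mem_preimage] at *
    rw [← h3, hstep, h2]

theorem isMarkov_of_driven (hW : ∀ n, Measurable (W n)) (hind : iIndepFun W m)
    (h0 : ∀ ω, Z 0 ω = x) (hstep : ∀ n ω, Z (n + 1) ω = Φ (Z n ω) (W n ω))
    (hlaw : ∀ n z y, m {ω | Φ z (W n ω) = y} = P z y) : IsMarkov m P Z := by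
  intro n z
  have hH : IsHistory W n {ω | ∀ k ≤ n, Z k ω = z k} := fun ω ω' h hω k hk =>
    (eq_of_inputs_eq h0 hstep h hk).symm.trans (hω k hk)
  have h := measure_history_inter hW hind h0 hstep hlaw hH (z n) (z (n + 1))
  have hsub : {ω | ∀ k ≤ n, Z k ω = z k} ∩ {ω | Z n ω = z n} = {ω | ∀ k ≤ n, Z k ω = z k} :=
    Set.inter_eq_left.2 fun ω hω => hω n le_rfl
  rw [hsub] at h
  rw [← h]
  congr 1
  ext ω
  constructor
  · exact fun hω => ⟨fun k hk => hω k (by omega), hω _ le_rfl⟩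
  · rintro ⟨h1, h2⟩ k hk
    rcases Nat.le_succ_iff.1 hk with hk | rfl
    · exact h1 k hk
    · exact h2

variable [Countable E] [IsProbabilityMeasure m]

/-- The bridge from path space to the kernel computations above: split by the position one step
earlier and apply the Markov property to the event of having avoided B so far. -/
theorem measure_avoid_inter (hW : ∀ n, Measurable (W n)) (hind : iIndepFun W m)
    (h0 : ∀ ω, Z 0 ω = x) (hstep : ∀ n ω, Z (n + 1) ω = Φ (Z n ω) (W n ω))
    (hlaw : ∀ n z y, m {ω | Φ z (W n ω) = y} = P z y) (B : Set E) (n : ℕ) (y : E) :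
    m ({ω | ∀ k, 1 ≤ k → k ≤ n → Z k ω ∉ B} ∩ {ω | Z n ω = y}) = excursion P B x n y := by
  have hist : ∀ n, IsHistory W n {ω | ∀ k, 1 ≤ k → k ≤ n → Z k ω ∉ B} :=
    fun n ω ω' h hω k hk1 hk => eq_of_inputs_eq h0 hstep h hk ▸ hω k hk1 hk
  induction n generalizing y with
  | zero =>
    by_cases hy : y = x
    · subst hy
      have : {ω | ∀ k, 1 ≤ k → k ≤ 0 → Z k ω ∉ B} ∩ {ω | Z 0 ω = y} = Set.univ := by
        ext ω
        simp only [Set.mem_inter_iff, Set.mem_ofPred_eq, h0, and_true, Set.mem_univ, iff_true]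
        intros
        omega
      rw [this]
      simp [excursion]
    · simp [h0, excursion, hy, Ne.symm hy]
  | succ n ih =>
    by_cases hy : y ∈ B
    · have : {ω | ∀ k, 1 ≤ k → k ≤ n + 1 → Z k ω ∉ B} ∩ {ω | Z (n + 1) ω = y} = ∅ := by
        ext ω
        simp only [Set.mem_inter_iff, Set.mem_ofPred_eq, Set.mem_empty_iff_false, iff_false]
        rintro ⟨h1, h2⟩
        exact h1 (n + 1) (by omega) le_rfl (h2 ▸ hy)
      simp [this, excursion, hy]
    · have hunion : {ω | ∀ k, 1 ≤ k → k ≤ n + 1 → Z k ω ∉ B} ∩ {ω | Z (n + 1) ω = y} =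
          ⋃ z, ({ω | ∀ k, 1 ≤ k → k ≤ n → Z k ω ∉ B} ∩ {ω | Z n ω = z}) ∩
            {ω | Z (n + 1) ω = y} := by
        ext ω
        simp only [Set.mem_inter_iff, Set.mem_ofPred_eq, Set.mem_iUnion]
        constructor
        · rintro ⟨h1, h2⟩
          exact ⟨Z n ω, ⟨fun k hk hk' => h1 k hk (by omega), rfl⟩, h2⟩
        · rintro ⟨z, ⟨h1, -⟩, h2⟩
          refine ⟨fun k hk hk' => ?_, h2⟩
          rcases Nat.le_succ_iff.1 hk' with hk' | rfl
          · exact h1 k hk hk'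
          · exact h2 ▸ hy
      rw [hunion, measure_iUnion]
      · simp only [measure_history_inter hW hind h0 hstep hlaw (hist n), ih]
        simp [excursion, hy]
      · intro z z' hz
        refine Set.disjoint_left.2 ?_
        rintro ω ⟨⟨-, h1⟩, -⟩ ⟨⟨-, h2⟩, -⟩
        exact hz (h1.symm.trans h2)
      · intro z
        refine IsHistory.measurableSet (n := n + 1) hW fun ω ω' h hω => ?_
        refine ⟨⟨fun k hk hk' => ?_, ?_⟩, ?_⟩
        · rw [← eq_of_inputs_eq h0 hstep h (hk'.trans n.le_succ)]
          exact hω.1.1 k hk hk'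
        · exact (eq_of_inputs_eq h0 hstep h n.le_succ).symm.trans hω.1.2
        · exact (eq_of_inputs_eq h0 hstep h le_rfl).symm.trans hω.2

theorem measure_avoid (hW : ∀ n, Measurable (W n)) (hind : iIndepFun W m)
    (h0 : ∀ ω, Z 0 ω = x) (hstep : ∀ n ω, Z (n + 1) ω = Φ (Z n ω) (W n ω))
    (hlaw : ∀ n z y, m {ω | Φ z (W n ω) = y} = P z y) (B : Set E) (n : ℕ) :
    m {ω | ∀ k, 1 ≤ k → k ≤ n → Z k ω ∉ B} = survive P B n x := by
  rw [← tsum_excursion]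
  simp only [← measure_avoid_inter hW hind h0 hstep hlaw B n]
  rw [← measure_iUnion]
  · congr 1
    ext ω
    simp
  · intro z z' hz
    refine Set.disjoint_left.2 ?_
    rintro ω ⟨-, h1⟩ ⟨-, h2⟩
    exact hz (h1.symm.trans h2)
  · intro z
    refine IsHistory.measurableSet (n := n) hW fun ω ω' h hω => ⟨fun k hk hk' => ?_, ?_⟩
    · rw [← eq_of_inputs_eq h0 hstep h hk']
      exact hω.1 k hk hk'
    · exact (eq_of_inputs_eq h0 hstep h le_rfl).symm.trans hω.2

theorem toENNReal_le_tsum (t : ℕ∞) :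
    (t : ℝ≥0∞) ≤ ∑' n : ℕ, {n : ℕ | (n : ℕ∞) < t}.indicator (1 : ℕ → ℝ≥0∞) n := by
  induction t using ENat.recTopCoe with
  | top => simp
  | coe N =>
    refine le_trans ?_ (ENNReal.sum_le_tsum (Finset.range N))
    rw [Finset.sum_congr rfl (g := fun _ => 1) fun n hn => by
      simpa [Set.indicator] using Finset.mem_range.1 hn]
    simp

/-- An expectation is the sum of its tails, and a hitting time above n means that B is avoided in
the steps 1, …, n. -/
theorem meanTime_le_tsum_survive (hW : ∀ n, Measurable (W n)) (hind : iIndepFun W m)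
    (h0 : ∀ ω, Z 0 ω = x) (hstep : ∀ n ω, Z (n + 1) ω = Φ (Z n ω) (W n ω))
    (hlaw : ∀ n z y, m {ω | Φ z (W n ω) = y} = P z y) (B : Set E) :
    meanTime m 1 Z B ≤ ∑' n, survive P B n x := by
  have hmeas : ∀ n, MeasurableSet {ω | ∀ k, 1 ≤ k → k ≤ n → Z k ω ∉ B} := fun n =>
    IsHistory.measurableSet (n := n) hW fun ω ω' h hω k hk hk' =>
      eq_of_inputs_eq h0 hstep h hk' ▸ hω k hk hk'
  calc meanTime m 1 Z B
      ≤ ∫⁻ ω, ∑' n, {ω | ∀ k, 1 ≤ k → k ≤ n → Z k ω ∉ B}.indicator 1 ω ∂m := by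
        refine lintegral_mono fun ω => (toENNReal_le_tsum _).trans ?_
        refine ENNReal.tsum_le_tsum fun n => ?_
        by_cases hn : (n : ℕ∞) < firstTime 1 Z B ω
        · have : ω ∈ {ω | ∀ k, 1 ≤ k → k ≤ n → Z k ω ∉ B} := fun k hk hk' hB => by
            refine absurd hn (not_lt.2 ((iInf₂_le k ⟨hk, hB⟩).trans ?_))
            exact_mod_cast hk'
          rw [Set.indicator_of_mem this]
          exact Set.indicator_le_self _ _ _
        · rw [Set.indicator_of_notMem (by exact hn)]
          exact bot_le
    _ = ∑' n, survive P B n x := by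
        rw [lintegral_tsum fun n => (measurable_one.indicator (hmeas n)).aemeasurable]
        refine tsum_congr fun n => ?_
        rw [lintegral_indicator_one (hmeas n), measure_avoid hW hind h0 hstep hlaw]

end Driven

theorem meanTime_zero_le {Ω E : Type*} [MeasurableSpace Ω] (m : Measure Ω) (Z : ℕ → Ω → E)
    (B : Set E) : meanTime m 0 Z B ≤ meanTime m 1 Z B := by
  refine lintegral_mono fun ω => ?_
  have h : firstTime 0 Z B ω ≤ firstTime 1 Z B ω :=
    le_iInf₂ fun n hn => iInf₂_le n ⟨Nat.zero_le _, hn.2⟩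
  exact ENat.toENNReal_mono h

end Chain

/-! ### Elementary inequalities and sums over probability mass functions -/

/-- The new length is at most (x − μ)⁺ + b. Bounding by offered service μ and offered inflow b,
instead of what is really moved, makes the cross term linear in the rates. -/
theorem sq_update_le {x d μ a b : ℕ} (hd : min x μ ≤ d) (hab : a ≤ b) :
    ((x - d + a : ℕ) : ℝ) ^ 2 ≤ x ^ 2 + μ ^ 2 + b ^ 2 + 2 * (x * (b - μ)) := by
  have hle : x - d + a ≤ x - μ + b := by omega
  have hle' : ((x - d + a : ℕ) : ℝ) ≤ ((x - μ + b : ℕ) : ℝ) := by exact_mod_cast hle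
  refine (pow_le_pow_left₀ (Nat.cast_nonneg _) hle' 2).trans ?_
  have hx : (0 : ℝ) ≤ x := Nat.cast_nonneg x
  have hb : (0 : ℝ) ≤ b := Nat.cast_nonneg b
  have hμ : (0 : ℝ) ≤ μ := Nat.cast_nonneg μ
  rcases le_total μ x with h | h
  · push_cast [Nat.cast_sub h]
    nlinarith [mul_nonneg hμ hb]
  · rw [Nat.sub_eq_zero_of_le h, zero_add]
    nlinarith [sq_nonneg ((x : ℝ) - μ), mul_nonneg hx hb]

theorem min_sum_le_sum_min {ι : Type*} (s : Finset ι) (x : ℕ) (r : ι → ℕ) :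
    min x (∑ j ∈ s, r j) ≤ ∑ j ∈ s, min x (r j) := by
  classical
  induction s using Finset.induction_on with
  | empty => simp
  | insert a s ha ih =>
    rw [Finset.sum_insert ha, Finset.sum_insert ha]
    omega

theorem PMF.tsum_mul_le_ofReal {α : Type*} (p : PMF α) {g : α → ℝ≥0∞} {h : α → ℝ} {c : ℝ}
    (h0 : ∀ a ∈ p.support, 0 ≤ h a) (hg : ∀ a ∈ p.support, g a ≤ ENNReal.ofReal (h a))
    (hc : HasSum (fun a => (p a).toReal * h a) c) : ∑' a, p a * g a ≤ ENNReal.ofReal c := by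
  have hnn : ∀ a, 0 ≤ (p a).toReal * h a := fun a => by
    by_cases ha : p a = 0
    · simp [ha]
    · exact mul_nonneg ENNReal.toReal_nonneg (h0 a ((p.mem_support_iff a).2 ha))
  rw [← hc.tsum_eq, ENNReal.ofReal_tsum_of_nonneg hnn hc.summable]
  refine ENNReal.tsum_le_tsum fun a => ?_
  by_cases ha : p a = 0
  · simp [ha]
  · rw [ENNReal.ofReal_mul ENNReal.toReal_nonneg, ENNReal.ofReal_toReal (p.apply_ne_top a)]
    gcongr
    exact hg a ((p.mem_support_iff a).2 ha)

theorem PMF.tsum_bind_mul {α β : Type*} (p : PMF α) (f : α → PMF β) (v : β → ℝ≥0∞) :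
    ∑' y, p.bind f y * v y = ∑' a, p a * ∑' y, f a y * v y := by
  simp only [PMF.bind_apply, ← ENNReal.tsum_mul_right, ← ENNReal.tsum_mul_left, mul_assoc]
  exact ENNReal.tsum_comm

theorem PMF.tsum_map_mul {α β : Type*} (p : PMF α) (f : α → β) (v : β → ℝ≥0∞) :
    ∑' y, p.map f y * v y = ∑' a, p a * v (f a) := by
  rw [← PMF.bind_pure_comp, PMF.tsum_bind_mul]
  refine tsum_congr fun a => ?_
  congr 1
  rw [tsum_eq_single (f a)]
  · simp
  · intro b hb
    simp [hb]

theorem PMF.hasSum_toReal {α : Type*} (p : PMF α) : HasSum (fun a => (p a).toReal) 1 := by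
  have h := ENNReal.hasSum_toReal (f := fun a => p a) p.tsum_coe_ne_top
  rwa [← ENNReal.tsum_toReal_eq (fun a => p.apply_ne_top a), p.tsum_coe, ENNReal.toReal_one] at h

instance QState.instCountable (N : ℕ) : Countable (QState N) := by
  refine Function.Injective.countable (f := fun z : QState N => (z.X, z.Y, z.U)) fun z w h => ?_
  simp only [Prod.mk.injEq] at h
  exact QState.ext h.1 h.2.1 h.2.2

/-! ### The quadratic Lyapunov function and its one-slot increment -/

namespace Network

variable {N M : ℕ} {S : Type*}

/-- The total of the queues. -/
def backlog (z : QState N) : ℕ := ∑ i, (z.X i + z.Y i + z.U i)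

theorem cast_backlog (z : QState N) :
    (backlog z : ℝ) = ∑ i, ((z.X i : ℝ) + z.Y i + z.U i) := by
  simp [backlog]

theorem queue_le_backlog (z : QState N) (i : Fin N) : z.X i + z.Y i + z.U i ≤ backlog z :=
  Finset.single_le_sum (f := fun i => z.X i + z.Y i + z.U i) (fun _ _ => Nat.zero_le _)
    (Finset.mem_univ i)

theorem finite_backlog_le (c : ℕ) : {z : QState N | backlog z ≤ c}.Finite := by
  have hfin := Set.finite_Icc (0 : Fin N → ℕ) fun _ => c
  refine Set.Finite.of_injOn (f := fun z : QState N => (z.X, z.Y, z.U)) ?_ ?_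
    (hfin.prod (hfin.prod hfin))
  · intro z hz
    have h : ∀ i, z.X i + z.Y i + z.U i ≤ c := fun i => (queue_le_backlog z i).trans hz
    exact ⟨⟨fun i => Nat.zero_le _, fun i => by have := h i; simp only; omega⟩,
      ⟨fun i => Nat.zero_le _, fun i => by have := h i; simp only; omega⟩,
      ⟨fun i => Nat.zero_le _, fun i => by have := h i; simp only; omega⟩⟩
  · intro z _ w _ h
    simp only [Prod.mk.injEq] at h
    exact QState.ext h.1 h.2.1 h.2.2

/-- The quadratic Lyapunov function. -/
noncomputable def lyapunov (net : Network N M S) (z : QState N) : ℝ :=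
  ∑ i, ((z.X i : ℝ) ^ 2 + (z.Y i : ℝ) ^ 2 + net.unit ^ 2 * (z.U i : ℝ) ^ 2)

theorem lyapunov_nonneg (net : Network N M S) (z : QState N) : 0 ≤ net.lyapunov z :=
  Finset.sum_nonneg fun _ _ => by positivity

/-- The service that is offered to the own queue of `i` on the link `(i, j)`. -/
def offered (net : Network N M S) (s : S) (k : Fin M) (own : Fin N → Bool) (i : Fin N) :
    Option (Fin N) → ℕ
  | some j => net.rate s k i (some j)
  | none => if own i then net.rate s k i none else 0

/-- The service that is offered to the relay queue of `i`. -/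
def offeredRelay (net : Network N M S) (s : S) (k : Fin M) (own : Fin N → Bool) (i : Fin N) : ℕ :=
  if own i then 0 else net.rate s k i none

theorem ownSent_eq_min (net : Network N M S) (z : QState N) (s : S) (k : Fin M)
    (own : Fin N → Bool) (i : Fin N) (j : Option (Fin N)) :
    net.ownSent z s k own i j = min (z.X i) (net.offered s k own i j) := by
  cases j with
  | some j => rfl
  | none => by_cases h : own i <;> simp [ownSent, offered, h]

theorem relaySent_eq_min (net : Network N M S) (z : QState N) (s : S) (k : Fin M)
    (own : Fin N → Bool) (i : Fin N) :
    net.relaySent z s k own i = min (z.Y i) (net.offeredRelay s k own i) := by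
  by_cases h : own i <;> simp [relaySent, offeredRelay, h]

/-- The weight of a power vector together with a queue selection. -/
noncomputable def gain (net : Network N M S) (z : QState N) (s : S) (k : Fin M)
    (own : Fin N → Bool) : ℝ :=
  ∑ i, ((z.X i : ℝ) * ((net.offered s k own i none : ℝ) + ∑ j, (net.rate s k i (some j) : ℝ))
    + z.Y i * ((net.offeredRelay s k own i : ℝ) - ∑ j, (net.rate s k j (some i) : ℝ))
    - net.unit * z.U i * net.power k i)

/-- Exchanging the two station indices turns differential backlogs into inflow and outflow of each
queue. What remains is the loss from serving the shorter queue on the links to the base station: it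
is nonnegative, and zero under max-weight. -/
theorem weight_sub_gain (net : Network N M S) (z : QState N) (s : S) (k : Fin M)
    (own : Fin N → Bool) :
    net.weight z s k - net.gain z s k own =
      ∑ i, (max (z.X i : ℝ) (z.Y i) - if own i then (z.X i : ℝ) else z.Y i) *
        (net.rate s k i none : ℝ) := by
  have hcomm : ∑ i, ∑ j, (z.Y j : ℝ) * (net.rate s k i (some j) : ℝ) =
      ∑ i, ∑ j, (z.Y i : ℝ) * (net.rate s k j (some i) : ℝ) := Finset.sum_comm
  have hw : net.weight z s k = ∑ i, ((∑ j, (z.X i : ℝ) * (net.rate s k i (some j) : ℝ))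
      - (∑ j, (z.Y i : ℝ) * (net.rate s k j (some i) : ℝ))
      + max (z.X i : ℝ) (z.Y i) * (net.rate s k i none : ℝ)
      - net.unit * (z.U i : ℝ) * net.power k i) := by
    simp only [weight, sub_mul, Finset.sum_sub_distrib, Finset.sum_add_distrib, hcomm]
  rw [hw, gain, ← Finset.sum_sub_distrib]
  refine Finset.sum_congr rfl fun i _ => ?_
  simp only [← Finset.mul_sum, offered, offeredRelay]
  by_cases h : own i <;> simp [h] <;> ring

theorem gain_le_weight (net : Network N M S) (z : QState N) (s : S) (k : Fin M)
    (own : Fin N → Bool) : net.gain z s k own ≤ net.weight z s k := by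
  rw [← sub_nonneg, weight_sub_gain]
  refine Finset.sum_nonneg fun i _ => mul_nonneg ?_ (Nat.cast_nonneg _)
  split_ifs <;> simp

theorem IsMaxWeight.gain_eq_weight {net : Network N M S} {Δ : Policy N M S}
    (hΔ : net.IsMaxWeight Δ) (z : QState N) (s : S) (k : Fin M) :
    net.gain z s k (Δ.own z s) = net.weight z s k := by
  refine (sub_eq_zero.1 ?_).symm
  rw [weight_sub_gain]
  refine Finset.sum_eq_zero fun i _ => ?_
  cases h : Δ.own z s i with
  | true => simp [hΔ.own_true z s i h]
  | false => simp [hΔ.own_false z s i h]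

/-- Everything that happens in a slot is bounded. -/
theorem exists_bound [Finite S] (net : Network N M S) : ∃ L : ℕ, ∀ s k own i,
    ∑ j, net.offered s k own i j ≤ L ∧ net.offeredRelay s k own i ≤ L ∧
    ∑ j, net.rate s k j (some i) ≤ L ∧ net.budget i ≤ L ∧ ∑ j, net.level k i j ≤ L := by
  obtain ⟨L, hL⟩ := Finite.exists_le fun p : S × Fin M × (Fin N → Bool) × Fin N =>
    ∑ j, net.offered p.1 p.2.1 p.2.2.1 p.2.2.2 j + net.offeredRelay p.1 p.2.1 p.2.2.1 p.2.2.2 +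
    ∑ j, net.rate p.1 p.2.1 j (some p.2.2.2) + net.budget p.2.2.2 +
    ∑ j, net.level p.2.1 p.2.2.2 j
  refine ⟨L, fun s k own i => ?_⟩
  have := hL (s, k, own, i)
  simp only at this
  refine ⟨?_, ?_, ?_, ?_, ?_⟩ <;> omega

/-- `sq_update_le` is applied to each queue. Each of X and Y contributes two squares of at most L²,
and U contributes two of at most unit²·L², whence the constant; the cross terms assemble into the
load minus `gain`. -/
theorem lyapunov_step_le (net : Network N M S) {L : ℕ} {s : S} {k : Fin M} {own : Fin N → Bool}
    {a : Fin N → ℕ} (hL : ∀ i,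
      ∑ j, net.offered s k own i j ≤ L ∧ net.offeredRelay s k own i ≤ L ∧
      ∑ j, net.rate s k j (some i) ≤ L ∧ net.budget i ≤ L ∧ ∑ j, net.level k i j ≤ L)
    (ha : ∀ i, a i ≤ L) (z : QState N) :
    net.lyapunov (net.step z a s k own) ≤ net.lyapunov z + N * ((4 + 2 * net.unit ^ 2) * L ^ 2)
      + 2 * (∑ i, (z.X i : ℝ) * a i - net.unit ^ 2 * ∑ i, (z.U i : ℝ) * net.budget i
        - net.gain z s k own) := by
  have hN : (N : ℝ) * ((4 + 2 * net.unit ^ 2) * L ^ 2) =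
      ∑ _i : Fin N, (4 + 2 * net.unit ^ 2) * (L : ℝ) ^ 2 := by simp
  rw [hN, lyapunov, lyapunov, gain, Finset.mul_sum, ← Finset.sum_sub_distrib,
    ← Finset.sum_sub_distrib, Finset.mul_sum, ← Finset.sum_add_distrib, ← Finset.sum_add_distrib]
  refine Finset.sum_le_sum fun i _ => ?_
  obtain ⟨h1, h2, h3, h4, h5⟩ := hL i
  have hX := sq_update_le (x := z.X i) (d := ∑ j, net.ownSent z s k own i j)
    (μ := ∑ j, net.offered s k own i j) (a := a i) (b := a i) (by
      simp only [ownSent_eq_min]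
      exact min_sum_le_sum_min _ _ _) le_rfl
  have hY := sq_update_le (x := z.Y i) (d := net.relaySent z s k own i)
    (μ := net.offeredRelay s k own i) (a := ∑ j, net.ownSent z s k own j (some i))
    (b := ∑ j, net.rate s k j (some i)) (relaySent_eq_min net z s k own i).ge
    (Finset.sum_le_sum fun j _ => min_le_right _ _)
  have hU := sq_update_le (x := z.U i) (d := net.budget i) (μ := net.budget i)
    (a := ∑ j, net.level k i j) (b := ∑ j, net.level k i j) (min_le_right _ _) le_rfl
  have hU' := mul_le_mul_of_nonneg_left hU (sq_nonneg net.unit)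
  have hsq : ∀ {n : ℕ}, n ≤ L → (n : ℝ) ^ 2 ≤ (L : ℝ) ^ 2 := fun h =>
    pow_le_pow_left₀ (Nat.cast_nonneg _) (by exact_mod_cast h) 2
  have q1 := hsq h1
  have q2 := hsq h2
  have q3 := hsq h3
  have q4 := mul_le_mul_of_nonneg_left (hsq h4) (sq_nonneg net.unit)
  have q5 := mul_le_mul_of_nonneg_left (hsq h5) (sq_nonneg net.unit)
  have q6 := hsq (ha i)
  have hoff : ((∑ j, net.offered s k own i j : ℕ) : ℝ) =
      net.offered s k own i none + ∑ j, (net.rate s k i (some j) : ℝ) := by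
    rw [Fintype.sum_option]
    push_cast
    rfl
  have hpow : net.power k i = net.unit * ((∑ j, net.level k i j : ℕ) : ℝ) := by
    rw [power]
    push_cast
    rfl
  have hrel : ((∑ j, net.rate s k j (some i) : ℕ) : ℝ) = ∑ j, (net.rate s k j (some i) : ℝ) := by
    push_cast
    rfl
  rw [← hoff, ← hrel, hpow]
  simp only [step]
  linarith

end Network

/-! ### From stabilizability to a slack proportional to the backlog -/

theorem ae_tendsto_frequency {Ω S : Type*} [MeasurableSpace Ω] {m : Measure Ω}
    [IsProbabilityMeasure m] [MeasurableSpace S] [MeasurableSingletonClass S] {π : PMF S}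
    {s : ℕ → Ω → S} (hs : ∀ n, Measurable (s n)) (hind : iIndepFun s m)
    (hlaw : ∀ n, m.map (s n) = π.toMeasure) (t : S) :
    Network.HasTimeAverage m (fun n ω => ({t} : Set S).indicator (fun _ => (1 : ℝ)) (s n ω))
      (π t).toReal := by
  have hmeas : Measurable (({t} : Set S).indicator fun _ => (1 : ℝ)) :=
    measurable_const.indicator (measurableSet_singleton t)
  have hX : ∀ ω, ({t} : Set S).indicator (fun _ => (1 : ℝ)) (s 0 ω) =
      (s 0 ⁻¹' {t}).indicator 1 ω := fun ω => rfl
  have hmean : ∫ ω, ({t} : Set S).indicator (fun _ => (1 : ℝ)) (s 0 ω) ∂m = (π t).toReal := by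
    simp only [hX]
    rw [integral_indicator_one (hs 0 (measurableSet_singleton t)), measureReal_def,
      ← Measure.map_apply (hs 0) (measurableSet_singleton t), hlaw,
      π.toMeasure_apply_singleton t (measurableSet_singleton t)]
  rw [← hmean]
  refine strong_law_ae_real (fun n ω => ({t} : Set S).indicator (fun _ => (1 : ℝ)) (s n ω))
    ?_ ?_ ?_
  · simp only [hX]
    exact (integrable_const (1 : ℝ)).indicator (hs 0 (measurableSet_singleton t))
  · exact fun i j hij => (hind.indepFun hij).comp hmeas hmeas
  · exact fun i => IdentDistrib.comp
      ⟨(hs i).aemeasurable, (hs 0).aemeasurable, by rw [hlaw, hlaw]⟩ hmeas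

theorem exists_pos_lt_of_finite {ι : Type*} [Finite ι] {f : ι → ℝ} (hf : ∀ i, 0 < f i) :
    ∃ ε > 0, ∀ i, ε < f i := by
  have h : ∀ᶠ ε in 𝓝[>] (0 : ℝ), ∀ i, ε < f i :=
    eventually_all.2 fun i => mem_of_superset (Ioo_mem_nhdsGT (hf i)) fun _ h => h.2
  obtain ⟨ε, h1, h2⟩ := (h.and self_mem_nhdsWithin).exists
  exact ⟨ε, h2, h1⟩

namespace Network

variable {N M : ℕ} {S : Type*}

/-- Needed so that the error from replacing π by empirical frequencies is linear in the backlog,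
uniformly in the state, and can be absorbed by the slack. -/
theorem exists_abs_weight_le [Finite S] (net : Network N M S) :
    ∃ K > 0, ∀ z s k, |net.weight z s k| ≤ K * backlog z := by
  obtain ⟨R, hR⟩ := Finite.exists_le fun p : S × Fin M × Fin N =>
    ∑ j, (net.rate p.1 p.2.1 p.2.2 (some j) : ℝ) + net.rate p.1 p.2.1 p.2.2 none +
      net.unit * net.power p.2.1 p.2.2
  refine ⟨N * |R| + 1, by positivity, fun z s k => ?_⟩
  have hb : (0 : ℝ) ≤ backlog z := Nat.cast_nonneg _
  have hq : ∀ i, (z.X i : ℝ) + z.Y i + z.U i ≤ backlog z := fun i => by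
    exact_mod_cast queue_le_backlog z i
  have hX : ∀ i, (0 : ℝ) ≤ z.X i := fun i => Nat.cast_nonneg _
  have hY : ∀ i, (0 : ℝ) ≤ z.Y i := fun i => Nat.cast_nonneg _
  have hU : ∀ i, (0 : ℝ) ≤ z.U i := fun i => Nat.cast_nonneg _
  have hterm : ∀ i, |(∑ j, ((z.X i : ℝ) - (z.Y j : ℝ)) * (net.rate s k i (some j) : ℝ))
      + max (z.X i : ℝ) (z.Y i : ℝ) * (net.rate s k i none : ℝ)
      - (net.unit * (z.U i : ℝ)) * net.power k i| ≤ |R| * backlog z := by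
    intro i
    have hp : 0 ≤ net.unit * net.power k i :=
      mul_nonneg net.unit_pos.le (mul_nonneg net.unit_pos.le (by positivity))
    have h1 : |∑ j, ((z.X i : ℝ) - (z.Y j : ℝ)) * (net.rate s k i (some j) : ℝ)| ≤
        ∑ j, (backlog z : ℝ) * (net.rate s k i (some j) : ℝ) := by
      refine (Finset.abs_sum_le_sum_abs _ _).trans (Finset.sum_le_sum fun j _ => ?_)
      rw [abs_mul, Nat.abs_cast]
      gcongr
      rw [abs_le]
      constructor <;> linarith [hq i, hq j, hX i, hX j, hY i, hY j, hU i, hU j]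
    have h2 : |max (z.X i : ℝ) (z.Y i : ℝ) * (net.rate s k i none : ℝ)| ≤
        backlog z * (net.rate s k i none : ℝ) := by
      rw [abs_mul, Nat.abs_cast]
      gcongr
      rw [abs_of_nonneg (le_max_of_le_left (hX i))]
      exact max_le (by linarith [hq i, hY i, hU i]) (by linarith [hq i, hX i, hU i])
    have h3 : |(net.unit * (z.U i : ℝ)) * net.power k i| ≤
        backlog z * (net.unit * net.power k i) := by
      rw [mul_right_comm, mul_comm, abs_mul, abs_of_nonneg hp, abs_of_nonneg (hU i)]
      gcongr
      exact le_add_self.trans (queue_le_backlog z i)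
    refine (abs_sub _ _).trans ?_
    refine (add_le_add ((abs_add_le _ _).trans (add_le_add h1 h2)) h3).trans ?_
    rw [← Finset.mul_sum, ← mul_add, ← mul_add, mul_comm]
    gcongr
    exact (hR (s, k, i)).trans (le_abs_self R)
  refine (Finset.abs_sum_le_sum_abs _ _).trans ((Finset.sum_le_sum fun i _ => hterm i).trans ?_)
  simp only [Finset.sum_const, Finset.card_univ, Fintype.card_fin, nsmul_eq_mul]
  linarith

/-- The queues z are frozen while the path of decisions runs, so linearity of `gain` reduces its
time average to the average rates and powers of that path. -/
theorem sum_gain (net : Network N M S) (z : QState N) (s : ℕ → S) (k : ℕ → Fin M)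
    (own : ℕ → Fin N → Bool) (T : ℕ) :
    ∑ n ∈ Finset.range T, net.gain z (s n) (k n) (own n) = ∑ i,
      ((z.X i : ℝ) * ((∑ n ∈ Finset.range T,
          if own n i then (net.rate (s n) (k n) i none : ℝ) else 0) +
          ∑ j, ∑ n ∈ Finset.range T, (net.rate (s n) (k n) i (some j) : ℝ)) +
        z.Y i * ((∑ n ∈ Finset.range T,
          if own n i then 0 else (net.rate (s n) (k n) i none : ℝ)) -
          ∑ j, ∑ n ∈ Finset.range T, (net.rate (s n) (k n) j (some i) : ℝ)) -
        net.unit * z.U i * ∑ n ∈ Finset.range T, net.power (k n) i) := by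
  simp only [gain]
  rw [Finset.sum_comm]
  refine Finset.sum_congr rfl fun i _ => ?_
  rw [Finset.sum_comm (s := Finset.univ), Finset.sum_comm (s := Finset.univ),
    ← Finset.sum_add_distrib, ← Finset.sum_sub_distrib]
  simp only [Finset.mul_sum, ← Finset.sum_add_distrib, ← Finset.sum_sub_distrib]
  refine Finset.sum_congr rfl fun n _ => ?_
  simp only [offered, offeredRelay, Nat.cast_ite, Nat.cast_zero]

/-- If the arrival rates are stabilizable, then the mean weight of the max-weight policy exceeds
the load by a multiple of the backlog. -/
theorem Stabilizable.exists_slack [Fintype S] [MeasurableSpace S] [MeasurableSingletonClass S]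
    {net : Network N M S} {π : PMF S} {lam : Fin N → ℝ} (hstab : net.Stabilizable π lam)
    {Δ : Policy N M S} (hΔ : net.IsMaxWeight Δ) : ∃ ε > 0, ∀ z : QState N,
      ∑ i, (z.X i : ℝ) * lam i - net.unit ^ 2 * ∑ i, (z.U i : ℝ) * net.budget i
        - ∑ t, (π t).toReal * net.weight z t (Δ.pow z t) ≤ -(ε * backlog z) := by
  obtain ⟨Ω, _, m, _, s, k, own, direct, relay, pw, link, hs, -, -, hind, hlaw, -, hlink, hdirect,
    hrelay, hpw, hX, hY, hU⟩ := hstab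
  have hu := net.unit_pos
  obtain ⟨K, hK, hweight⟩ := net.exists_abs_weight_le
  obtain ⟨ε₁, hε₁, hX'⟩ := exists_pos_lt_of_finite fun i => sub_pos.2 (hX i)
  obtain ⟨ε₂, hε₂, hY'⟩ := exists_pos_lt_of_finite fun i => sub_pos.2 (hY i)
  obtain ⟨ε₃, hε₃, hU'⟩ := exists_pos_lt_of_finite fun i => mul_pos hu (sub_pos.2 (hU i))
  set ε := min ε₁ (min ε₂ ε₃)
  have hε : 0 < ε := lt_min hε₁ (lt_min hε₂ hε₃)
  have hεX : ∀ i, ε < direct i + ∑ j, link i j - lam i := fun i =>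
    (min_le_left _ _).trans_lt (hX' i)
  have hεY : ∀ i, ε < relay i - ∑ j, link j i := fun i =>
    ((min_le_right _ _).trans (min_le_left _ _)).trans_lt (hY' i)
  have hεU : ∀ i, ε < net.unit * (net.unit * net.budget i - pw i) := fun i =>
    ((min_le_right _ _).trans (min_le_right _ _)).trans_lt (hU' i)
  -- With |S| topologies, each frequency off by less than δ and weights at most K·backlog, the total
  -- error is at most (ε/2)·backlog.
  set δ := ε / (2 * K * (Fintype.card S + 1))
  have hδ : 0 < δ := by positivity
  obtain ⟨ω, hω⟩ := ((ae_all_iff.2 fun i => ae_all_iff.2 fun j => hlink i j).and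
    ((ae_all_iff.2 hdirect).and ((ae_all_iff.2 hrelay).and ((ae_all_iff.2 hpw).and
      (ae_all_iff.2 fun t => ae_tendsto_frequency hs hind hlaw t))))).exists
  obtain ⟨wlink, wdirect, wrelay, wpw, wfreq⟩ := hω
  have e1 : ∀ᶠ T : ℕ in atTop, ∀ i, ε < (∑ n ∈ Finset.range T,
      if own n ω i then (net.rate (s n ω) (k n ω) i none : ℝ) else 0) / T +
      ∑ j, (∑ n ∈ Finset.range T, (net.rate (s n ω) (k n ω) i (some j) : ℝ)) / T - lam i :=
    eventually_all.2 fun i => (((wdirect i).add (tendsto_finsetSum _ fun j _ =>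
      wlink i j)).sub_const _).eventually (lt_mem_nhds (hεX i))
  have e2 : ∀ᶠ T : ℕ in atTop, ∀ i, ε < (∑ n ∈ Finset.range T,
      if own n ω i then 0 else (net.rate (s n ω) (k n ω) i none : ℝ)) / T -
      ∑ j, (∑ n ∈ Finset.range T, (net.rate (s n ω) (k n ω) j (some i) : ℝ)) / T :=
    eventually_all.2 fun i => ((wrelay i).sub (tendsto_finsetSum _ fun j _ =>
      wlink j i)).eventually (lt_mem_nhds (hεY i))
  have e3 : ∀ᶠ T : ℕ in atTop, ∀ i, ε < net.unit * (net.unit * net.budget i -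
      (∑ n ∈ Finset.range T, net.power (k n ω) i) / T) :=
    eventually_all.2 fun i => (((wpw i).const_sub _).const_mul _).eventually
      (lt_mem_nhds (hεU i))
  have e4 : ∀ᶠ T : ℕ in atTop, ∀ t, |(∑ n ∈ Finset.range T,
      ({t} : Set S).indicator (fun _ => (1 : ℝ)) (s n ω)) / T - (π t).toReal| < δ :=
    eventually_all.2 fun t => (Metric.tendsto_nhds.1 (wfreq t) δ hδ).mono fun T hT => by
      rwa [Real.dist_eq] at hT
  -- The sample point and T are chosen before z, so the slack is uniform in the queues.
  obtain ⟨T, h1, h2, h3, h4, hT⟩ :=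
    (e1.and (e2.and (e3.and (e4.and (eventually_gt_atTop 0))))).exists
  have hT' : (0 : ℝ) < T := Nat.cast_pos.2 hT
  refine ⟨ε / 2, by positivity, fun z => ?_⟩
  set w : S → ℝ := fun t => net.weight z t (Δ.pow z t)
  set freq : S → ℝ := fun t =>
    (∑ n ∈ Finset.range T, ({t} : Set S).indicator (fun _ => (1 : ℝ)) (s n ω)) / T
  have hfreq : ∑ t, freq t * w t = (∑ n ∈ Finset.range T, w (s n ω)) / T := by
    simp only [freq, div_mul_eq_mul_div, ← Finset.sum_div, Finset.sum_mul]
    rw [Finset.sum_comm]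
    congr 1
    refine Finset.sum_congr rfl fun n _ => ?_
    rw [Finset.sum_eq_single (s n ω)]
    · simp
    · intro t _ ht
      simp [Ne.symm ht]
    · simp
  have hbl : (0 : ℝ) ≤ backlog z := Nat.cast_nonneg _
  have hclose : ∑ t, freq t * w t - ∑ t, (π t).toReal * w t ≤ ε / 2 * backlog z := by
    rw [← Finset.sum_sub_distrib]
    calc ∑ t, (freq t * w t - (π t).toReal * w t)
        ≤ ∑ _t : S, δ * (K * backlog z) := by
          refine Finset.sum_le_sum fun t _ => ?_
          rw [← sub_mul]
          refine (le_abs_self _).trans ?_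
          rw [abs_mul]
          exact mul_le_mul (h4 t).le (hweight z t _) (abs_nonneg _) hδ.le
      _ = (Fintype.card S * δ * K) * backlog z := by simp; ring
      _ ≤ ε / 2 * backlog z := by
          gcongr
          have : δ * (2 * K * (Fintype.card S + 1)) = ε := div_mul_cancel₀ _ (by positivity)
          nlinarith [mul_pos hδ hK]
  -- Slot by slot, the decision of the stabilizing policy gains no more than the max-weight decision
  -- would at the frozen queues z in the same topology.
  have hgain : (∑ n ∈ Finset.range T, net.gain z (s n ω) (k n ω) (own n ω)) / T ≤
      (∑ n ∈ Finset.range T, w (s n ω)) / T := by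
    gcongr with n hn
    exact (net.gain_le_weight z _ _ _).trans (hΔ.pow_max z _ _)
  rw [sum_gain, Finset.sum_div] at hgain
  have hload : ∑ i, (z.X i : ℝ) * lam i - net.unit ^ 2 * ∑ i, (z.U i : ℝ) * net.budget i
      + ε * backlog z ≤ (∑ n ∈ Finset.range T, w (s n ω)) / T := by
    refine le_trans ?_ hgain
    rw [cast_backlog, Finset.mul_sum, Finset.mul_sum, ← Finset.sum_sub_distrib,
      ← Finset.sum_add_distrib]
    refine Finset.sum_le_sum fun i _ => ?_
    have g1 := mul_le_mul_of_nonneg_left (h1 i).le (Nat.cast_nonneg (α := ℝ) (z.X i))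
    have g2 := mul_le_mul_of_nonneg_left (h2 i).le (Nat.cast_nonneg (α := ℝ) (z.Y i))
    have g3 := mul_le_mul_of_nonneg_left (h3 i).le (Nat.cast_nonneg (α := ℝ) (z.U i))
    rw [sub_div, add_div, mul_div_assoc, mul_div_assoc, mul_div_assoc, add_div, sub_div,
      Finset.sum_div Finset.univ, Finset.sum_div Finset.univ]
    linarith
  linarith

/-! ### The drift of the queue process and its transition law -/

theorem avg_trans (net : Network N M S) (Δ : Policy N M S) (ν : PMF (Fin N → ℕ)) (π : PMF S)
    (v : QState N → ℝ≥0∞) (z : QState N) :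
    Chain.avg (net.trans Δ ν π) v z = ∑' a, ν a * ∑' s, π s * v (net.next Δ z a s) := by
  simp only [Chain.avg, trans, PMF.tsum_bind_mul, PMF.tsum_map_mul]

/-- The drift of the Lyapunov function under the max-weight policy. -/
theorem Stabilizable.exists_drift [Fintype S] [MeasurableSpace S] [MeasurableSingletonClass S]
    {net : Network N M S} {Δ : Policy N M S} (hΔ : net.IsMaxWeight Δ) {ν : PMF (Fin N → ℕ)}
    {π : PMF S} {lam : Fin N → ℝ} {Amax : ℕ} (hA : ∀ a ∈ ν.support, ∀ i, a i ≤ Amax)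
    (hlam : ∀ i, HasSum (fun a : Fin N → ℕ => (ν a).toReal * (a i : ℝ)) (lam i))
    (hstab : net.Stabilizable π lam) : ∃ ε > 0, ∃ C : ℝ, 0 ≤ C ∧ ∀ z,
      Chain.avg (net.trans Δ ν π) (fun z => ENNReal.ofReal (net.lyapunov z)) z +
        ENNReal.ofReal (ε * backlog z) ≤ ENNReal.ofReal (net.lyapunov z) + ENNReal.ofReal C := by
  obtain ⟨ε, hε, hslack⟩ := hstab.exists_slack hΔ
  obtain ⟨L₀, hL₀⟩ := net.exists_bound
  set L := L₀ + Amax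
  set C : ℝ := N * ((4 + 2 * net.unit ^ 2) * L ^ 2)
  have hC : 0 ≤ C := by positivity
  refine ⟨2 * ε, by positivity, C, hC, fun z => ?_⟩
  set w : S → ℝ := fun t => net.weight z t (Δ.pow z t)
  set W : ℝ := ∑ t, (π t).toReal * w t
  set G : ℝ := net.unit ^ 2 * ∑ i, (z.U i : ℝ) * net.budget i
  set c : ℝ := net.lyapunov z + C - 2 * G
  have hstep : ∀ a ∈ ν.support, ∀ t, net.lyapunov (net.next Δ z a t) ≤
      c + 2 * ∑ i, (z.X i : ℝ) * a i - 2 * w t := by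
    intro a ha t
    have h := net.lyapunov_step_le (L := L) (s := t) (k := Δ.pow z t) (own := Δ.own z t) (a := a)
      (fun i => by
        obtain ⟨h1, h2, h3, h4, h5⟩ := hL₀ t (Δ.pow z t) (Δ.own z t) i
        exact ⟨le_add_right h1, le_add_right h2, le_add_right h3, le_add_right h4,
          le_add_right h5⟩) (fun i => le_add_left (hA a ha i)) z
    rw [hΔ.gain_eq_weight] at h
    refine h.trans (le_of_eq ?_)
    simp only [c, C, G, w]
    ring
  have hsumπ : ∑ t, (π t).toReal = 1 :=
    (hasSum_fintype fun t => (π t).toReal).unique π.hasSum_toReal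
  have hinner : ∀ b : ℝ, HasSum (fun t => (π t).toReal * (b - 2 * w t)) (b - 2 * W) := by
    intro b
    have h : b - 2 * W = ∑ t, (π t).toReal * (b - 2 * w t) := by
      simp only [mul_sub, Finset.sum_sub_distrib, ← Finset.sum_mul, hsumπ, one_mul, W,
        Finset.mul_sum]
      congr 1
      exact Finset.sum_congr rfl fun t _ => by ring
    rw [h]
    exact hasSum_fintype _
  -- The real upper bounds dominate a nonnegative function, so `ENNReal.ofReal` truncates nothing
  -- and real means may be used for the extended ones.
  have hpos : ∀ a ∈ ν.support, ∀ t, 0 ≤ c + 2 * ∑ i, (z.X i : ℝ) * a i - 2 * w t :=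
    fun a ha t => (net.lyapunov_nonneg _).trans (hstep a ha t)
  have houter : HasSum (fun a => (ν a).toReal * (c + 2 * ∑ i, (z.X i : ℝ) * a i - 2 * W))
      (c + 2 * ∑ i, (z.X i : ℝ) * lam i - 2 * W) := by
    have h1 := (hasSum_sum fun i (_ : i ∈ Finset.univ) => (hlam i).mul_left (z.X i : ℝ)).mul_left 2
    have h2 := (ν.hasSum_toReal.mul_right (c - 2 * W)).add h1
    have hfun : (fun a => (ν a).toReal * (c + 2 * ∑ i, (z.X i : ℝ) * a i - 2 * W)) = fun a =>
        (ν a).toReal * (c - 2 * W) + 2 * ∑ i, (z.X i : ℝ) * ((ν a).toReal * (a i : ℝ)) := by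
      funext a
      have : ∑ i, (z.X i : ℝ) * ((ν a).toReal * (a i : ℝ)) =
          (ν a).toReal * ∑ i, (z.X i : ℝ) * a i := by
        rw [Finset.mul_sum]
        exact Finset.sum_congr rfl fun i _ => by ring
      rw [this]
      ring
    have hval : c + 2 * ∑ i, (z.X i : ℝ) * lam i - 2 * W =
        1 * (c - 2 * W) + 2 * ∑ i, (z.X i : ℝ) * lam i := by ring
    rw [hfun, hval]
    exact h2
  have hpos' : ∀ a ∈ ν.support, 0 ≤ c + 2 * ∑ i, (z.X i : ℝ) * a i - 2 * W := fun a ha =>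
    (hinner _).nonneg fun t => mul_nonneg ENNReal.toReal_nonneg (hpos a ha t)
  have htotal : 0 ≤ c + 2 * ∑ i, (z.X i : ℝ) * lam i - 2 * W := houter.nonneg fun a => by
    by_cases ha : ν a = 0
    · simp [ha]
    · exact mul_nonneg ENNReal.toReal_nonneg (hpos' a ((ν.mem_support_iff a).2 ha))
  rw [avg_trans, ← ENNReal.ofReal_add (net.lyapunov_nonneg z) hC]
  calc _ ≤ ENNReal.ofReal (c + 2 * ∑ i, (z.X i : ℝ) * lam i - 2 * W) +
        ENNReal.ofReal (2 * ε * backlog z) := by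
        gcongr
        refine ν.tsum_mul_le_ofReal hpos' (fun a ha => ?_) houter
        exact π.tsum_mul_le_ofReal (fun t _ => hpos a ha t)
          (fun t _ => ENNReal.ofReal_le_ofReal (hstep a ha t)) (hinner _)
    _ ≤ _ := by
        rw [← ENNReal.ofReal_add htotal (by positivity)]
        refine ENNReal.ofReal_le_ofReal ?_
        have := hslack z
        simp only [c]
        linarith

theorem law_next [Fintype S] [MeasurableSpace S] [MeasurableSingletonClass S] (net : Network N M S)
    (Δ : Policy N M S) {ν : PMF (Fin N → ℕ)} {π : PMF S} {Ω : Type*} [MeasurableSpace Ω]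
    {m : Measure Ω} {A : ℕ → Ω → Fin N → ℕ} {s : ℕ → Ω → S} (hinput : IsIIDInput m ν π A s)
    (n : ℕ) (z y : QState N) :
    m {ω | net.next Δ z (A n ω) (s n ω) = y} = net.trans Δ ν π z y := by
  have hT : MeasurableSet {p : (Fin N → ℕ) × S | net.next Δ z p.1 p.2 = y} :=
    (Set.to_countable _).measurableSet
  have h := Measure.map_apply (μ := m)
    ((hinput.measurable_arrivals n).prodMk (hinput.measurable_topology n)) hT
  rw [hinput.law n, Measure.prod_apply hT] at h
  refine h.symm.trans ?_
  rw [lintegral_countable', trans, PMF.bind_apply]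
  refine tsum_congr fun a => ?_
  rw [ν.toMeasure_apply_singleton a (measurableSet_singleton a), mul_comm]
  congr 1
  rw [PMF.toMeasure_apply_eq_tsum, PMF.map_apply]
  refine tsum_congr fun t => ?_
  by_cases ht : net.next Δ z a t = y
  · simp [Set.indicator, ht]
  · simp [Set.indicator, ht, Ne.symm ht]

end Network

/-! ### The stability theorem -/

theorem lemma1 {N M : ℕ} {S : Type*} [Fintype S] [MeasurableSpace S] [MeasurableSingletonClass S]
    (net : Network N M S) (Δ : Network.Policy N M S) (hΔ : net.IsMaxWeight Δ)
    (ν : PMF (Fin N → ℕ)) (π : PMF S) (lam : Fin N → ℝ)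
    -- bounded arrivals with mean vector `lam`
    (Amax : ℕ) (hA : ∀ a ∈ ν.support, ∀ i, a i ≤ Amax)
    (hlam : ∀ i, HasSum (fun a : Fin N → ℕ => (ν a).toReal * (a i : ℝ)) (lam i))
    (hstab : net.Stabilizable π lam)
    {Ω : Type*} [MeasurableSpace Ω] (m : Measure Ω) [IsProbabilityMeasure m]
    (A : ℕ → Ω → Fin N → ℕ) (s : ℕ → Ω → S) (hinput : IsIIDInput m ν π A s) :
    -- the queues form a Markov chain, from each initial state
    (∀ z, Chain.IsMarkov m (net.trans Δ ν π) (net.queue Δ A s z)) ∧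
    -- the chain is positive recurrent
    Chain.PositiveRecurrent m (net.trans Δ ν π) (net.queue Δ A s) ∧
    -- each closed communicating class carries exactly one stationary distribution
    (∀ z, Chain.Essential (net.trans Δ ν π) z →
      ∃! ρ : PMF (QState N), Chain.Stationary (net.trans Δ ν π) ρ ∧
        ∀ y ∈ ρ.support, Chain.Reach (net.trans Δ ν π) z y) ∧
    -- all queues have finite mean under each stationary distribution
    (∀ ρ : PMF (QState N), Chain.Stationary (net.trans Δ ν π) ρ → ∀ i,
      ∑' z, ρ z * (z.X i : ℝ≥0∞) < ∞ ∧
      ∑' z, ρ z * (z.Y i : ℝ≥0∞) < ∞ ∧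
      ∑' z, ρ z * (z.U i : ℝ≥0∞) < ∞) := by
  have hW : ∀ n, Measurable fun ω => (A n ω, s n ω) := fun n =>
    (hinput.measurable_arrivals n).prodMk (hinput.measurable_topology n)
  have hstep : ∀ z n ω, net.queue Δ A s z (n + 1) ω =
      (fun z (p : (Fin N → ℕ) × S) => net.next Δ z p.1 p.2) (net.queue Δ A s z n ω)
        (A n ω, s n ω) := fun _ _ _ => rfl
  have hlaw : ∀ n z y, m {ω | (fun z (p : (Fin N → ℕ) × S) => net.next Δ z p.1 p.2) z
      (A n ω, s n ω) = y} = net.trans Δ ν π z y := net.law_next Δ hinput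
  obtain ⟨ε, hε, C, hC, hdrift⟩ := hstab.exists_drift hΔ hA hlam
  set V : QState N → ℝ≥0∞ := fun z => ENNReal.ofReal (net.lyapunov z)
  have hV : ∀ z, V z ≠ ∞ := fun z => ENNReal.ofReal_ne_top
  have hbound : ∀ z, Chain.avg (net.trans Δ ν π) V z ≤ V z + ENNReal.ofReal C := fun z =>
    le_self_add.trans (hdrift z)
  -- Beyond this level ε·backlog ≥ C + 1, so the drift is at most −1.
  set F : Finset (QState N) := (Network.finite_backlog_le ⌈(C + 1) / ε⌉₊).toFinset
  have hF : ∀ z, z ∉ F → Chain.avg (net.trans Δ ν π) V z + 1 ≤ V z := by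
    intro z hz
    have hz' : ⌈(C + 1) / ε⌉₊ < Network.backlog z := by
      simpa [F, Set.Finite.mem_toFinset] using hz
    have h1 : C + 1 ≤ ε * Network.backlog z := by
      have h2 : (C + 1) / ε ≤ Network.backlog z :=
        (Nat.le_ceil _).trans (by exact_mod_cast hz'.le)
      rwa [div_le_iff₀' hε] at h2
    refine (ENNReal.add_le_add_iff_right (ENNReal.ofReal_ne_top (r := C))).1 ?_
    refine le_trans ?_ (hdrift z)
    rw [add_assoc, add_comm 1, ← ENNReal.ofReal_one, ← ENNReal.ofReal_add hC zero_le_one]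
    gcongr
  have hreturn : ∀ z, Chain.Essential (net.trans Δ ν π) z →
      ∑' n, Chain.survive (net.trans Δ ν π) {z} n z < ∞ := fun z hz =>
    Chain.tsum_survive_singleton_lt_top hV ENNReal.ofReal_ne_top hbound hF hz
  refine ⟨fun z => Chain.isMarkov_of_driven
    (Φ := fun z (p : (Fin N → ℕ) × S) => net.next Δ z p.1 p.2) hW hinput.indep (fun _ => rfl) (hstep z) hlaw,
    ⟨fun z hz => ?_, fun z => ?_⟩, fun z hz => ?_, fun ρ hρ i => ?_⟩
  · exact (Chain.meanTime_le_tsum_survive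
      (Φ := fun z (p : (Fin N → ℕ) × S) => net.next Δ z p.1 p.2) hW hinput.indep (fun _ => rfl) (hstep z) hlaw _).trans_lt
      (hreturn z hz)
  · refine (Chain.meanTime_zero_le _ _ _).trans_lt ((Chain.meanTime_le_tsum_survive
      (Φ := fun z (p : (Fin N → ℕ) × S) => net.next Δ z p.1 p.2) hW hinput.indep (fun _ => rfl) (hstep z) hlaw _).trans_lt ?_)
    exact Chain.tsum_survive_lt_top hV ENNReal.ofReal_ne_top hbound hF
      (Chain.exists_essential (Chain.exists_reach_of_drift hV hF)) z
  · exact Chain.existsUnique_stationary hz (hreturn z hz).ne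
  · have hmean : ∑' z, ρ z * (Network.backlog z : ℝ≥0∞) < ∞ := by
      have h := hρ.tsum_le hV hdrift
      have heq : ∀ z : QState N, ρ z * ENNReal.ofReal (ε * Network.backlog z) =
          ENNReal.ofReal ε * (ρ z * (Network.backlog z : ℝ≥0∞)) := fun z => by
        rw [ENNReal.ofReal_mul hε.le, ENNReal.ofReal_natCast]
        ring
      simp only [heq, ENNReal.tsum_mul_left] at h
      by_contra htop
      rw [not_lt_top_iff.1 htop, ENNReal.mul_top (ENNReal.ofReal_pos.2 hε).ne'] at h
      exact absurd h (by simp)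
    have hle : ∀ q : QState N → ℕ, (∀ z, q z ≤ Network.backlog z) →
        ∑' z, ρ z * (q z : ℝ≥0∞) < ∞ := fun q hq =>
      (ENNReal.tsum_le_tsum fun z => by
        gcongr
        exact hq z).trans_lt hmean
    exact ⟨hle (fun z => z.X i) fun z => by have := Network.queue_le_backlog z i; omega,
      hle (fun z => z.Y i) fun z => by have := Network.queue_le_backlog z i; omega,
      hle (fun z => z.U i) fun z => by have := Network.queue_le_backlog z i; omega⟩
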